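/- Let $n\ge 2$ and let $\{k,l,m_1,\dots,m_{n-2}\}$ be the standard basis of $\mathbb{R}^n$, with dual basis $\omega^1,\dots,\omega^n$. Put $\eta=\omega^1\otimes\omega^2+\omega^2\otimes\omega^1+\sum_{i=3}^n\omega^i\otimes\omega^i$ and $\{k\}^\perp=\{w:\eta(k,w)=0\}$. Let $GN\subset GL(n,\mathbb{R})$ be the group of all invertible linear maps $f$ such that $f(k)\in\mathbb{R}k$, $\eta(f(w),f(\tilde w))=\eta(w,\tilde w)$ for all $w,\tilde w\in\{k\}^\perp$, and $\eta(f(k),f(z))=\eta(k,z)$ for all $z\in\mathbb{R}^n$. Let $M$ be a smooth $n$-dimensional manifold and let $P\to M$ be a $GN$-structure, i.e. a smooth principal subbundle, with structure group $GN$, of the bundle of linear frames $u:\mathbb{R}^n\to T_xM$. Let $\lambda_x=u(\mathbb{R}k)$ and $\Lambda_x=u(\{k\}^\perp)$ for any $u\in P_x$; these subspaces do not depend on $u$. Let $\lambda^*_x,\Lambda^*_x\subset T^*_xM$ be the annihilators of $\Lambda_x$ and $\lambda_x$ respectively, and put $T_xM^{1}=T_xM$, $T_xM^{0}=\Lambda_x$,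 $T_xM^{-1}=\lambda_x$, $T^*_xM^{1}=T^*_xM$, $T^*_xM^{0}=\Lambda^*_x$, $T^*_xM^{-1}=\lambda^*_x$. A tensor field with $r$ covariant and $t$ contravariant factors is of type $II$ (boost-order $0$) if at each point $x$ it lies in $$\sum_{\substack{s_1+\cdots+s_{r+t}=0\\ s_i\in\{-1,0,1\}}}T^*_xM^{s_1}\otimes\cdots\otimes T^*_xM^{s_r}\otimes T_xM^{s_{r+1}}\otimes\cdots\otimes T_xM^{s_{r+t}}.$$ Let $\nabla$ be a smooth torsion-free affine connection on $M$ which belongs to $P$, i.e. whose connection form with respect to every smooth local section of $P$ takes values in the Lie algebra of $GN$. Then the curvature tensor $R^\nabla$, given by $R^\nabla(X,Y)Z=\nabla_X\nabla_YZ-\nabla_Y\nabla_XZ-\nabla_{[X,Y]}Z$ and regarded as the tensor field $(X,Y,Z;\alpha)\mapsto\alpha(R^\nabla(X,Y)Z)$ with three covariant factors and one contravariant factor, is of type $II$. -/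

import Mathlib

open scoped Manifold ContDiff Topology

set_option linter.unusedSectionVars false

namespace NullGeometry

open Bundle FiberBundle VectorField

/-! ### The structure group -/

/-- The Minkowski inner product `η` on `ℝⁿ`, `n = d + 2`, in the null basis
`k = e₀, l = e₁, mᵢ = e_{i+2}`. -/
def minkowski {d : ℕ} (v w : EuclideanSpace ℝ (Fin (d + 2))) : ℝ :=
  v 0 * w 1 + v 1 * w 0 + ∑ i : Fin d, v i.succ.succ * w i.succ.succ

/-- The null vector `k`. -/
noncomputable def nullVec (d : ℕ) : EuclideanSpace ℝ (Fin (d + 2)) := EuclideanSpace.single 0 1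

theorem minkowski_smul_left {d : ℕ} (a : ℝ) (v w : EuclideanSpace ℝ (Fin (d + 2))) :
    minkowski (a • v) w = a * minkowski v w := by
  simp only [minkowski, PiLp.smul_apply, smul_eq_mul, mul_add, Finset.mul_sum, mul_assoc]

theorem minkowski_comm {d : ℕ} (v w : EuclideanSpace ℝ (Fin (d + 2))) :
    minkowski v w = minkowski w v := by
  simp only [minkowski, mul_comm]; ring

theorem minkowski_add_left {d : ℕ} (v v' w : EuclideanSpace ℝ (Fin (d + 2))) :
    minkowski (v + v') w = minkowski v w + minkowski v' w := by
  simp only [minkowski, PiLp.add_apply, add_mul, Finset.sum_add_distrib]; ring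

theorem nullVec_ne_zero (d : ℕ) : nullVec d ≠ 0 := by simp [nullVec]

/-- The null line `ℝk`. -/
noncomputable def nullLine (d : ℕ) : Submodule ℝ (EuclideanSpace ℝ (Fin (d + 2))) :=
  Submodule.span ℝ {nullVec d}

/-- The hyperplane `{k}^⊥`. -/
noncomputable def nullPerp (d : ℕ) : Submodule ℝ (EuclideanSpace ℝ (Fin (d + 2))) where
  carrier := {w | minkowski (nullVec d) w = 0}
  add_mem' {a b} ha hb := by
    simp only [Set.mem_ofPred_eq] at *
    rw [minkowski_comm, minkowski_add_left, minkowski_comm a, minkowski_comm b, ha, hb, add_zero]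
  zero_mem' := by simp [minkowski]
  smul_mem' c a ha := by
    simp only [Set.mem_ofPred_eq] at *
    rw [minkowski_comm, minkowski_smul_left, minkowski_comm a, ha, mul_zero]

/-- The defining conditions of the elements of `GN`. -/
structure PreservesNull {d : ℕ}
    (f : EuclideanSpace ℝ (Fin (d + 2)) ≃L[ℝ] EuclideanSpace ℝ (Fin (d + 2))) : Prop where
  map_nullVec : f (nullVec d) ∈ nullLine d
  perp : ∀ w ∈ nullPerp d, ∀ w' ∈ nullPerp d, minkowski (f w) (f w') = minkowski w w'
  null : ∀ z, minkowski (f (nullVec d)) (f z) = minkowski (nullVec d) z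

theorem PreservesNull.exists_smul {d : ℕ}
    {f : EuclideanSpace ℝ (Fin (d + 2)) ≃L[ℝ] EuclideanSpace ℝ (Fin (d + 2))}
    (hf : PreservesNull f) : ∃ a : ℝ, a ≠ 0 ∧ f (nullVec d) = a • nullVec d := by
  obtain ⟨a, ha⟩ := Submodule.mem_span_singleton.1 hf.map_nullVec
  refine ⟨a, ?_, ha.symm⟩
  rintro rfl
  exact nullVec_ne_zero d (f.map_eq_zero_iff.1 (by rw [← ha, zero_smul]))

theorem PreservesNull.mem_perp_iff {d : ℕ}
    {f : EuclideanSpace ℝ (Fin (d + 2)) ≃L[ℝ] EuclideanSpace ℝ (Fin (d + 2))}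
    (hf : PreservesNull f) (w : EuclideanSpace ℝ (Fin (d + 2))) :
    f w ∈ nullPerp d ↔ w ∈ nullPerp d := by
  obtain ⟨a, ha, hk⟩ := hf.exists_smul
  have h := hf.null w
  rw [hk, minkowski_smul_left] at h
  change minkowski _ _ = 0 ↔ minkowski _ _ = 0
  rw [← h, mul_eq_zero, or_iff_right ha]

/-- The group `GN ⊂ GL(n, ℝ)`, `n = d + 2`. -/
def GN (d : ℕ) :
    Subgroup (EuclideanSpace ℝ (Fin (d + 2)) ≃L[ℝ] EuclideanSpace ℝ (Fin (d + 2))) where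
  carrier := {f | PreservesNull f}
  one_mem' := ⟨Submodule.mem_span_singleton_self _, fun _ _ _ _ => rfl, fun _ => rfl⟩
  mul_mem' {f g} hf hg := by
    refine ⟨?_, fun w hw w' hw' => ?_, fun z => ?_⟩
    · obtain ⟨a, -, ha⟩ := hg.exists_smul
      change f (g _) ∈ _
      rw [ha, map_smul]
      exact Submodule.smul_mem _ _ hf.map_nullVec
    · exact (hf.perp _ ((hg.mem_perp_iff w).2 hw) _ ((hg.mem_perp_iff w').2 hw')).trans
        (hg.perp w hw w' hw')
    · obtain ⟨a, -, ha⟩ := hg.exists_smul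
      change minkowski (f (g _)) (f (g _)) = _
      rw [← hg.null z, ha, map_smul, minkowski_smul_left, minkowski_smul_left, hf.null]
  inv_mem' {f} hf := by
    obtain ⟨a, ha, hk⟩ := hf.exists_smul
    have hk' : f⁻¹ (nullVec d) = a⁻¹ • nullVec d := by
      change f.symm (nullVec d) = _
      rw [ContinuousLinearEquiv.symm_apply_eq, map_smul, hk, smul_smul, inv_mul_cancel₀ ha,
        one_smul]
    have hff : ∀ z, f (f⁻¹ z) = z := fun z => f.apply_symm_apply z
    refine ⟨?_, fun w hw w' hw' => ?_, fun z => ?_⟩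
    · rw [hk']
      exact Submodule.smul_mem _ _ (Submodule.mem_span_singleton_self _)
    · rw [← hf.perp _ ((hf.mem_perp_iff _).1 (by rwa [hff])) _
        ((hf.mem_perp_iff _).1 (by rwa [hff])), hff, hff]
    · have h := hf.null (f⁻¹ z)
      rw [hff, hk, minkowski_smul_left] at h
      rw [hk', minkowski_smul_left, ← h, ← mul_assoc, inv_mul_cancel₀ ha, one_mul]

/-! ### Boost order -/

section

variable {V : Type*} [AddCommGroup V] [Module ℝ V]

/-- Tensors on `V` with `r` covariant and `t` contravariant factors, as multilinear functions of
`r` vectors and `t` covectors. -/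
abbrev TensorSpace (V : Type*) [AddCommGroup V] [Module ℝ V] (r t : ℕ) : Type _ :=
  MultilinearMap ℝ (fun _ : Fin r => V) (MultilinearMap ℝ (fun _ : Fin t => Module.Dual ℝ V) ℝ)

/-- The tensor `θ₁ ⊗ ⋯ ⊗ θᵣ ⊗ v₁ ⊗ ⋯ ⊗ vₜ`. -/
noncomputable def TensorSpace.pure {r t : ℕ} (θ : Fin r → Module.Dual ℝ V) (v : Fin t → V) :
    TensorSpace V r t :=
  ((MultilinearMap.mkPiAlgebra ℝ (Fin r) ℝ).compLinearMap θ).smulRight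
    ((MultilinearMap.mkPiAlgebra ℝ (Fin t) ℝ).compLinearMap
      fun j => Module.Dual.eval ℝ V (v j))

theorem TensorSpace.pure_apply {r t : ℕ} (θ : Fin r → Module.Dual ℝ V) (v : Fin t → V)
    (x : Fin r → V) (α : Fin t → Module.Dual ℝ V) :
    TensorSpace.pure θ v x α = (∏ i, θ i (x i)) * ∏ j, α j (v j) := by
  simp [TensorSpace.pure]

/-- The filtration `V¹ = V`, `V⁰ = Λ`, `V⁻¹ = λ` of `V`. -/
def vectorLevel (lam Lam : Submodule ℝ V) : SignType → Submodule ℝ V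
  | .pos => ⊤
  | .zero => Lam
  | .neg => lam

/-- The filtration of `V*`: everything, the annihilator of `λ`, the annihilator of `Λ`. -/
def covectorLevel (lam Lam : Submodule ℝ V) : SignType → Submodule ℝ (Module.Dual ℝ V)
  | .pos => ⊤
  | .zero => lam.dualAnnihilator
  | .neg => Lam.dualAnnihilator

/-- Tensors of boost order `s`: the sum, over all `s₁ + ⋯ + s_{r+t} = s` with `sᵢ ∈ {-1, 0, 1}`, of
the tensor products of the filtration levels `sᵢ`. -/
def boostOrder (lam Lam : Submodule ℝ V) (r t : ℕ) (s : ℤ) : Submodule ℝ (TensorSpace V r t) :=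
  ⨆ (σ : Fin r → SignType) (τ : Fin t → SignType)
    (_ : ∑ i, (σ i : ℤ) + ∑ j, (τ j : ℤ) = s),
    Submodule.span ℝ {T | ∃ θ v, (∀ i, θ i ∈ covectorLevel lam Lam (σ i)) ∧
      (∀ j, v j ∈ vectorLevel lam Lam (τ j)) ∧ T = TensorSpace.pure θ v}

variable (V) in
/-- A vector as a tensor with one contravariant factor. -/
noncomputable def evalOne : V →ₗ[ℝ] MultilinearMap ℝ (fun _ : Fin 1 => Module.Dual ℝ V) ℝ where
  toFun w := (MultilinearMap.mkPiAlgebra ℝ (Fin 1) ℝ).compLinearMap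
    fun _ => Module.Dual.eval ℝ V w
  map_add' v w := by ext α; simp
  map_smul' c v := by ext α; simp

theorem evalOne_apply (w : V) (α : Fin 1 → Module.Dual ℝ V) : evalOne V w α = α 0 w := by
  simp [evalOne]

end

/-! ### G-structures -/

section

variable {E : Type*} [NormedAddCommGroup E] [NormedSpace ℝ E]

/-- The Lie algebra of a (closed) linear group `G`: all `A` with `exp (t A) ∈ G` for all `t`. -/
def linearLieAlgebra (G : Subgroup (E ≃L[ℝ] E)) : Set (E →L[ℝ] E) :=
  {A | ∀ t : ℝ, ∃ g ∈ G, (g : E →L[ℝ] E) = NormedSpace.exp (t • A)}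

variable {M : Type*} [TopologicalSpace M] [ChartedSpace E M] [IsManifold 𝓘(ℝ, E) ∞ M]

/-- A family of frames `s y : E ≃ T_y M` which is smooth on `U`. -/
def IsSmoothFrameOn (s : (y : M) → (E ≃L[ℝ] TangentSpace 𝓘(ℝ, E) y)) (U : Set M) : Prop :=
  ∀ v : E, CMDiff[U] ∞ (T% (fun y : M ↦ s y v))

variable (M) in
/-- A `G`-structure on `M`: a principal subbundle, with structure group `G`, of the frame bundle.
The group acts on frames `u : E ≃ T_x M` on the right by `u a = u ∘ a`, and smoothness of the
subbundle is the existence of smooth local sections. -/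
structure GStructure (G : Subgroup (E ≃L[ℝ] E)) where
  frames : (x : M) → Set (E ≃L[ℝ] TangentSpace 𝓘(ℝ, E) x)
  comp_mem : ∀ {x : M} {u : E ≃L[ℝ] TangentSpace 𝓘(ℝ, E) x} {a : E ≃L[ℝ] E},
    u ∈ frames x → a ∈ G → a.trans u ∈ frames x
  exists_eq_comp : ∀ {x : M} {u u' : E ≃L[ℝ] TangentSpace 𝓘(ℝ, E) x},
    u ∈ frames x → u' ∈ frames x → ∃ a ∈ G, u' = a.trans u
  exists_section : ∀ x : M, ∃ U : Set M, IsOpen U ∧ x ∈ U ∧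
    ∃ s : (y : M) → (E ≃L[ℝ] TangentSpace 𝓘(ℝ, E) y),
      IsSmoothFrameOn s U ∧ ∀ y ∈ U, s y ∈ frames y

namespace GStructure

variable {G : Subgroup (E ≃L[ℝ] E)}

/-- The connection `cov` belongs to `P`: with respect to each smooth local section of `P`, its
connection form takes values in the Lie algebra of `G`. -/
def IsConnectionIn (P : GStructure M G)
    (cov : CovariantDerivative 𝓘(ℝ, E) E (TangentSpace 𝓘(ℝ, E) : M → Type _)) : Prop :=
  ∀ (U : Set M) (s : (y : M) → (E ≃L[ℝ] TangentSpace 𝓘(ℝ, E) y)), IsOpen U →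
    IsSmoothFrameOn s U → (∀ y ∈ U, s y ∈ P.frames y) →
    ∀ y ∈ U, ∀ X : TangentSpace 𝓘(ℝ, E) y, ∃ A ∈ linearLieAlgebra G,
      ∀ v : E, cov (fun z ↦ s z v) y X = s y (A v)

end GStructure

end

section

variable {d : ℕ} {M : Type*} [TopologicalSpace M]
  [ChartedSpace (EuclideanSpace ℝ (Fin (d + 2))) M] [IsManifold (𝓡 (d + 2)) ∞ M]

/-- The null distribution `λ` of a `GN`-structure: the common value of `u (ℝk)` for the frames `u`
over `x`. -/
noncomputable def GStructure.nullDist (P : GStructure M (GN d)) (x : M) :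
    Submodule ℝ (TangentSpace (𝓡 (d + 2)) x) :=
  ⨆ u ∈ P.frames x, (nullLine d).map (u : _ →ₗ[ℝ] TangentSpace (𝓡 (d + 2)) x)

/-- The distribution `Λ` of a `GN`-structure: the common value of `u ({k}^⊥)` for the frames `u`
over `x`. -/
noncomputable def GStructure.perpDist (P : GStructure M (GN d)) (x : M) :
    Submodule ℝ (TangentSpace (𝓡 (d + 2)) x) :=
  ⨆ u ∈ P.frames x, (nullPerp d).map (u : _ →ₗ[ℝ] TangentSpace (𝓡 (d + 2)) x)

theorem GStructure.nullDist_eq (P : GStructure M (GN d)) {x : M}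
    {u : EuclideanSpace ℝ (Fin (d + 2)) ≃L[ℝ] TangentSpace (𝓡 (d + 2)) x} (hu : u ∈ P.frames x) :
    P.nullDist x = (nullLine d).map (u : _ →ₗ[ℝ] TangentSpace (𝓡 (d + 2)) x) := by
  refine le_antisymm (iSup₂_le fun u' hu' ↦ ?_) (le_iSup₂_of_le u hu le_rfl)
  obtain ⟨a, ha, rfl⟩ := P.exists_eq_comp hu hu'
  rintro _ ⟨w, hw, rfl⟩
  refine ⟨a w, ?_, rfl⟩
  obtain ⟨c, rfl⟩ := Submodule.mem_span_singleton.1 hw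
  rw [map_smul]
  exact Submodule.smul_mem _ _ (PreservesNull.map_nullVec ha)

theorem GStructure.perpDist_eq (P : GStructure M (GN d)) {x : M}
    {u : EuclideanSpace ℝ (Fin (d + 2)) ≃L[ℝ] TangentSpace (𝓡 (d + 2)) x} (hu : u ∈ P.frames x) :
    P.perpDist x = (nullPerp d).map (u : _ →ₗ[ℝ] TangentSpace (𝓡 (d + 2)) x) := by
  refine le_antisymm (iSup₂_le fun u' hu' ↦ ?_) (le_iSup₂_of_le u hu le_rfl)
  obtain ⟨a, ha, rfl⟩ := P.exists_eq_comp hu hu'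
  rintro _ ⟨w, hw, rfl⟩
  exact ⟨a w, (PreservesNull.mem_perp_iff ha w).2 hw, rfl⟩

/-- A tensor at `x` is of type II with respect to a `GN`-structure if it has boost order `0`. -/
def GStructure.IsTypeII (P : GStructure M (GN d)) (x : M) {r t : ℕ}
    (T : TensorSpace (TangentSpace (𝓡 (d + 2)) x) r t) : Prop :=
  T ∈ boostOrder (P.nullDist x) (P.perpDist x) r t 0

end

/-! ### Curvature -/

section
variable {E : Type*} [NormedAddCommGroup E] [NormedSpace ℝ E] [FiniteDimensional ℝ E]
  {M : Type*} [TopologicalSpace M] [T2Space M] [ChartedSpace E M] [IsManifold 𝓘(ℝ, E) ∞ M]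

theorem cov_contMDiffAt
    (cov : CovariantDerivative 𝓘(ℝ, E) E (TangentSpace 𝓘(ℝ, E) : M → Type _))
    [hc : CovariantDerivative.ContMDiffCovariantDerivative cov ∞] {U : Set M} (hU : IsOpen U)
    {σ : Π y : M, TangentSpace 𝓘(ℝ, E) y} (hσ : CMDiff[U] ∞ (T% σ)) {x : M} (hx : x ∈ U) :
    ContMDiffAt 𝓘(ℝ, E) (𝓘(ℝ, E).prod 𝓘(ℝ, E →L[ℝ] E)) ∞
      (fun y ↦ (⟨y, cov σ y⟩ : TotalSpace (E →L[ℝ] E)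
        fun y ↦ TangentSpace 𝓘(ℝ, E) y →L[ℝ] TangentSpace 𝓘(ℝ, E) y)) x := by
  obtain ⟨χ, -, hχ⟩ := (SmoothBumpFunction.nhds_basis_tsupport (I := 𝓘(ℝ, E)) x).mem_iff.1
    (hU.mem_nhds hx)
  have hs : CMDiff ∞ (T% ((χ : M → ℝ) • σ)) := by
    intro y
    by_cases hy : y ∈ tsupport χ
    · exact (χ.contMDiff y).smul_section ((hσ y (hχ hy)).contMDiffAt (hU.mem_nhds (hχ hy)))
    · have : (T% ((χ : M → ℝ) • σ)) =ᶠ[𝓝 y] T% (0 : Π y : M, TangentSpace 𝓘(ℝ, E) y) := by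
        filter_upwards [(isClosed_tsupport _).isOpen_compl.mem_nhds hy] with z hz
        have : χ z = 0 := image_eq_zero_of_notMem_tsupport hz
        simp [this]
      exact (contMDiff_zeroSection ℝ _ y).congr_of_eventuallyEq this
  have h1 := hc.contMDiff.contMDiff (σ := (χ : M → ℝ) • σ) hs.contMDiffOn
  refine (h1 x trivial).contMDiffAt Filter.univ_mem |>.congr_of_eventuallyEq ?_
  filter_upwards [χ.eventuallyEq_one.eventuallyEq_nhds, hU.mem_nhds hx] with y hy hyU
  have : cov σ y = cov ((χ : M → ℝ) • σ) y := by
    refine cov.isCovariantDerivativeOn.congr_of_eventuallyEq (s := Set.univ)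
      (((hσ y hyU).contMDiffAt (hU.mem_nhds hyU)).mdifferentiableAt (by simp))
      ((hs y).mdifferentiableAt (by simp)) Filter.univ_mem ?_
    filter_upwards [hy] with z hz
    simp [hz]
  simp [this]

variable (cov : CovariantDerivative 𝓘(ℝ, E) E (TangentSpace 𝓘(ℝ, E) : M → Type _))

/-- The curvature operator `R(X, Y) Z = ∇_X ∇_Y Z - ∇_Y ∇_X Z - ∇_[X,Y] Z` on vector fields. -/
noncomputable def curvatureOp (X Y Z : Π y : M, TangentSpace 𝓘(ℝ, E) y) (x : M) :
    TangentSpace 𝓘(ℝ, E) x :=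
  cov (fun y ↦ cov Z y (Y y)) x (X x) - cov (fun y ↦ cov Z y (X y)) x (Y x)
    - cov Z x (mlieBracket 𝓘(ℝ, E) X Y x)

variable {cov} [CovariantDerivative.ContMDiffCovariantDerivative cov ∞]
  {X X' Y Y' Z Z' : Π y : M, TangentSpace 𝓘(ℝ, E) y} {U : Set M} {x : M}

theorem mdifferentiableAt_cov (hU : IsOpen U) (hZ : CMDiff[U] ∞ (T% Z)) (hx : x ∈ U)
    (hY : MDiffAt (T% Y) x) : MDiffAt (T% (fun y ↦ cov Z y (Y y))) x :=
  MDifferentiableAt.clm_bundle_apply (E₁ := fun y : M ↦ TangentSpace 𝓘(ℝ, E) y)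
    (E₂ := fun y : M ↦ TangentSpace 𝓘(ℝ, E) y) (b := fun y ↦ y) (ϕ := fun y ↦ cov Z y)
    ((cov_contMDiffAt cov hU hZ hx).mdifferentiableAt (by simp)) hY

theorem curvatureOp_swap : curvatureOp cov X Y Z x = - curvatureOp cov Y X Z x := by
  rw [curvatureOp, curvatureOp, mlieBracket_swap_apply, map_neg]; abel

theorem curvatureOp_tensorial_left (hU : IsOpen U) (hZ : CMDiff[U] ∞ (T% Z)) (hx : x ∈ U)
    (Y : Π y : M, TangentSpace 𝓘(ℝ, E) y) :
    TensorialAt 𝓘(ℝ, E) E (fun X ↦ curvatureOp cov X Y Z x) x where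
  smul {f σ} hf hσ := by
    have h := cov.isCovariantDerivativeOnUniv.leibniz (mdifferentiableAt_cov (cov := cov) hU hZ hx hσ) hf
    have e : (fun y ↦ cov Z y ((f • σ) y)) = f • fun y ↦ cov Z y (σ y) := by
      ext1 y; simp
    simp only [curvatureOp]
    rw [e, h, mlieBracket_smul_left hf hσ]
    simp
    module
  add {σ σ'} hσ hσ' := by
    have h := cov.isCovariantDerivativeOnUniv.add (mdifferentiableAt_cov (cov := cov) hU hZ hx hσ)
      (mdifferentiableAt_cov (cov := cov) hU hZ hx hσ')
    have e : (fun y ↦ cov Z y ((σ + σ') y)) =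
        (fun y ↦ cov Z y (σ y)) + fun y ↦ cov Z y (σ' y) := by
      ext1 y; simp
    simp only [curvatureOp]
    rw [e, h, mlieBracket_add_left hσ hσ']
    simp
    module

theorem curvatureOp_tensorial_right (hU : IsOpen U) (hZ : CMDiff[U] ∞ (T% Z)) (hx : x ∈ U)
    (X : Π y : M, TangentSpace 𝓘(ℝ, E) y) :
    TensorialAt 𝓘(ℝ, E) E (fun Y ↦ curvatureOp cov X Y Z x) x where
  smul {f σ} hf hσ := by
    have h := (curvatureOp_tensorial_left (cov := cov) hU hZ hx X).smul hf hσ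
    rw [curvatureOp_swap, h, ← smul_neg, ← curvatureOp_swap]
  add {σ σ'} hσ hσ' := by
    have h := (curvatureOp_tensorial_left (cov := cov) hU hZ hx X).add hσ hσ'
    rw [curvatureOp_swap, h, neg_add, ← curvatureOp_swap, ← curvatureOp_swap]

theorem curvatureOp_add (hU : IsOpen U) (hx : x ∈ U) (hX : MDiffAt (T% X) x)
    (hY : MDiffAt (T% Y) x) (hZ : CMDiff[U] ∞ (T% Z)) (hZ' : CMDiff[U] ∞ (T% Z')) :
    curvatureOp cov X Y (Z + Z') x = curvatureOp cov X Y Z x + curvatureOp cov X Y Z' x := by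
  have hd {W : Π y : M, TangentSpace 𝓘(ℝ, E) y} (hW : CMDiff[U] ∞ (T% W)) {y : M} (hy : y ∈ U) :
      MDiffAt (T% W) y := ((hW y hy).contMDiffAt (hU.mem_nhds hy)).mdifferentiableAt (by simp)
  have e {W : Π y : M, TangentSpace 𝓘(ℝ, E) y} (hW : MDiffAt (T% W) x) :
      cov (fun y ↦ cov (Z + Z') y (W y)) x =
        cov (fun y ↦ cov Z y (W y)) x + cov (fun y ↦ cov Z' y (W y)) x := by
    have m1 := mdifferentiableAt_cov (cov := cov) hU hZ hx hW
    have m2 := mdifferentiableAt_cov (cov := cov) hU hZ' hx hW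
    have h := cov.isCovariantDerivativeOnUniv.add m1 m2
    rw [← h]
    refine cov.isCovariantDerivativeOn.congr_of_eventuallyEq (s := Set.univ)
      (mdifferentiableAt_cov hU (hZ.add_section hZ') hx hW)
      (mdifferentiableAt_add_section m1 m2) Filter.univ_mem ?_
    filter_upwards [hU.mem_nhds hx] with y hy
    simp [cov.isCovariantDerivativeOnUniv.add (hd hZ hy) (hd hZ' hy)]
  simp only [curvatureOp]
  rw [e hX, e hY, cov.isCovariantDerivativeOnUniv.add (hd hZ hx) (hd hZ' hx)]
  simp
  module


theorem mdifferentiableAt_mvfderiv_apply {f : M → ℝ} (hf : CMDiffAt ∞ f x)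
    (hY : MDiffAt (T% Y) x) : MDiffAt (fun y ↦ d% f y (Y y)) x := by
  have h := (hf.mfderiv_const (m := 1) (by rw [one_add_one_eq_two]; exact ENat.LEInfty.out)).mdifferentiableAt one_ne_zero
  have h2 := MDifferentiableAt.clm_apply_of_inCoordinates
    (E₁ := fun y : M ↦ TangentSpace 𝓘(ℝ, E) y) (E₂ := fun y : ℝ ↦ TangentSpace 𝓘(ℝ, ℝ) y)
    (b₁ := fun y ↦ y) (b₂ := f) (ϕ := fun y ↦ mfderiv% f y) h hY
    (hf.mdifferentiableAt (by simp))
  rw [mdifferentiableAt_totalSpace] at h2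
  have h3 := h2.2
  simp only [mfld_simps] at h3
  exact h3

/-- `X (Y f) - Y (X f) = [X, Y] f`, multiplied by an arbitrary vector field. -/
theorem mvfderiv_mlieBracket_smul {f : M → ℝ} (hU : IsOpen U) (hx : x ∈ U)
    (hX : CMDiff[U] ∞ (T% X)) (hY : CMDiff[U] ∞ (T% Y)) (hZ : CMDiff[U] ∞ (T% Z))
    (hf : CMDiff[U] ∞ f) :
    (d% (fun y ↦ d% f y (Y y)) x (X x) - d% (fun y ↦ d% f y (X y)) x (Y x)
      - d% f x (mlieBracket 𝓘(ℝ, E) X Y x)) • Z x = 0 := by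
  have a {W : Π y : M, TangentSpace 𝓘(ℝ, E) y} (hW : CMDiff[U] ∞ (T% W)) {y : M} (hy : y ∈ U) :
      CMDiffAt ∞ (T% W) y := (hW y hy).contMDiffAt (hU.mem_nhds hy)
  have d {W : Π y : M, TangentSpace 𝓘(ℝ, E) y} (hW : CMDiff[U] ∞ (T% W)) {y : M} (hy : y ∈ U) :
      MDiffAt (T% W) y := (a hW hy).mdifferentiableAt (by simp)
  have fa {y : M} (hy : y ∈ U) : CMDiffAt ∞ f y := (hf y hy).contMDiffAt (hU.mem_nhds hy)
  have fd {y : M} (hy : y ∈ U) : MDiffAt f y := (fa hy).mdifferentiableAt (by simp)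
  have two : minSmoothness ℝ 2 ≤ (∞ : ℕ∞ω) := by
    rw [minSmoothness_of_isRCLikeNormedField]; exact ENat.LEInfty.out
  have two' : IsManifold 𝓘(ℝ, E) (minSmoothness ℝ 2) M := IsManifold.of_le two
  have three' : IsManifold 𝓘(ℝ, E) (minSmoothness ℝ 3) M := by
    refine IsManifold.of_le (n := ∞) ?_
    rw [minSmoothness_of_isRCLikeNormedField]; exact ENat.LEInfty.out
  have three'' : IsManifold 𝓘(ℝ, E) (((2 : ℕ∞) : ℕ∞ω) + 1) M :=
    IsManifold.of_le (n := ∞) (by norm_cast)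
  have br {V W : Π y : M, TangentSpace 𝓘(ℝ, E) y} (hV : CMDiff[U] ∞ (T% V))
      (hW : CMDiff[U] ∞ (T% W)) : MDiffAt (T% (mlieBracket 𝓘(ℝ, E) V W)) x :=
    (((a hV hx).of_le ENat.LEInfty.out).mlieBracket_vectorField (m := 1) (n := 2)
      ((a hW hx).of_le ENat.LEInfty.out) (by
        rw [minSmoothness_of_isRCLikeNormedField]; norm_num [one_add_one_eq_two])).mdifferentiableAt
        one_ne_zero
  have J1 := leibniz_identity_mlieBracket_apply ((a hX hx).of_le two) ((a hY hx).of_le two)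
    ((a hZ hx).of_le two)
  have J2 := leibniz_identity_mlieBracket_apply ((a hX hx).of_le two) ((a hY hx).of_le two)
    (((fa hx).smul_section (a hZ hx)).of_le two)
  have e {V W : Π y : M, TangentSpace 𝓘(ℝ, E) y} (hV : CMDiff[U] ∞ (T% V))
      (hW : CMDiff[U] ∞ (T% W)) :
      mlieBracket 𝓘(ℝ, E) V (mlieBracket 𝓘(ℝ, E) W (f • Z)) x =
        d% (fun y ↦ d% f y (W y)) x (V x) • Z x
        + d% f x (W x) • mlieBracket 𝓘(ℝ, E) V Z x
        + d% f x (V x) • mlieBracket 𝓘(ℝ, E) W Z x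
        + f x • mlieBracket 𝓘(ℝ, E) V (mlieBracket 𝓘(ℝ, E) W Z) x := by
    have h : ∀ᶠ y in 𝓝 x, mlieBracket 𝓘(ℝ, E) W (f • Z) y =
        ((fun y ↦ d% f y (W y)) • Z + f • mlieBracket 𝓘(ℝ, E) W Z) y := by
      filter_upwards [hU.mem_nhds hx] with y hy
      rw [mlieBracket_smul_right (fd hy) (d hZ hy)]
      simp
    have m1 := mdifferentiableAt_mvfderiv_apply (fa hx) (d hW hx)
    rw [Filter.EventuallyEq.mlieBracket_vectorField_eq (V := V) (V₁ := V) Filter.EventuallyEq.rfl h,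
      mlieBracket_add_right (m1.smul_section (d hZ hx)) ((fd hx).smul_section (br hW hZ)),
      mlieBracket_smul_right m1 (d hZ hx), mlieBracket_smul_right (fd hx) (br hW hZ)]
    abel
  change _ = mlieBracket _ _ (f • Z) x + _ at J2
  rw [mlieBracket_smul_right (fd hx) (d hZ hx)] at J2
  have J3 := (e hX hY).symm.trans (J2.trans (congrArg _ (e hY hX)))
  rw [J1] at J3
  rw [sub_smul, sub_smul, sub_sub, sub_eq_zero]
  rw [← sub_eq_zero] at J3 ⊢
  refine Eq.trans ?_ J3
  module

theorem curvatureOp_smul (hU : IsOpen U) (hx : x ∈ U) (hX : CMDiff[U] ∞ (T% X))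
    (hY : CMDiff[U] ∞ (T% Y)) (hZ : CMDiff[U] ∞ (T% Z)) {f : M → ℝ} (hf : CMDiff[U] ∞ f) :
    curvatureOp cov X Y (f • Z) x = f x • curvatureOp cov X Y Z x := by
  have d {W : Π y : M, TangentSpace 𝓘(ℝ, E) y} (hW : CMDiff[U] ∞ (T% W)) {y : M} (hy : y ∈ U) :
      MDiffAt (T% W) y := ((hW y hy).contMDiffAt (hU.mem_nhds hy)).mdifferentiableAt (by simp)
  have fa {y : M} (hy : y ∈ U) : CMDiffAt ∞ f y := (hf y hy).contMDiffAt (hU.mem_nhds hy)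
  have fd {y : M} (hy : y ∈ U) : MDiffAt f y := (fa hy).mdifferentiableAt (by simp)
  have e {V W : Π y : M, TangentSpace 𝓘(ℝ, E) y} (hV : CMDiff[U] ∞ (T% V))
      (hW : CMDiff[U] ∞ (T% W)) : cov (fun y ↦ cov (f • Z) y (W y)) x (V x) =
        f x • cov (fun y ↦ cov Z y (W y)) x (V x) + d% f x (V x) • cov Z x (W x)
          + d% f x (W x) • cov Z x (V x) + d% (fun y ↦ d% f y (W y)) x (V x) • Z x := by
    have m0 := mdifferentiableAt_cov (cov := cov) hU hZ hx (d hW hx)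
    have m1 := mdifferentiableAt_mvfderiv_apply (fa hx) (d hW hx)
    have h : cov (fun y ↦ cov (f • Z) y (W y)) x =
        cov ((f • fun y ↦ cov Z y (W y)) + (fun y ↦ d% f y (W y)) • Z) x := by
      refine cov.isCovariantDerivativeOn.congr_of_eventuallyEq (s := Set.univ)
        (mdifferentiableAt_cov hU (hf.smul_section hZ) hx (d hW hx))
        (mdifferentiableAt_add_section ((fd hx).smul_section m0) (m1.smul_section (d hZ hx)))
        Filter.univ_mem ?_
      filter_upwards [hU.mem_nhds hx] with y hy
      rw [cov.isCovariantDerivativeOnUniv.leibniz (d hZ hy) (fd hy)]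
      simp
    rw [h, cov.isCovariantDerivativeOnUniv.add ((fd hx).smul_section m0)
        (m1.smul_section (d hZ hx)), cov.isCovariantDerivativeOnUniv.leibniz m0 (fd hx),
      cov.isCovariantDerivativeOnUniv.leibniz (d hZ hx) m1]
    simp
    abel
  have c := mvfderiv_mlieBracket_smul hU hx hX hY hZ hf
  simp only [curvatureOp]
  rw [e hX hY, e hY hX, cov.isCovariantDerivativeOnUniv.leibniz (d hZ hx) (fd hx)]
  simp only [add_apply, smul_apply,
    ContinuousLinearMap.smulRight_apply]
  rw [sub_smul, sub_smul, sub_sub, sub_eq_zero] at c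
  rw [← sub_eq_zero] at c ⊢
  refine Eq.trans ?_ c
  module

theorem curvatureOp_congr (hU : IsOpen U) (hx : x ∈ U) (hX : MDiffAt (T% X) x)
    (hY : MDiffAt (T% Y) x) (hZ : CMDiff[U] ∞ (T% Z)) (hZ' : CMDiff[U] ∞ (T% Z'))
    (h : ∀ y ∈ U, Z y = Z' y) : curvatureOp cov X Y Z x = curvatureOp cov X Y Z' x := by
  have d {W : Π y : M, TangentSpace 𝓘(ℝ, E) y} (hW : CMDiff[U] ∞ (T% W)) {y : M} (hy : y ∈ U) :
      MDiffAt (T% W) y := ((hW y hy).contMDiffAt (hU.mem_nhds hy)).mdifferentiableAt (by simp)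
  have l : ∀ y ∈ U, cov Z y = cov Z' y := fun y hy ↦
    cov.isCovariantDerivativeOn.congr_of_eqOn (d hZ hy) (d hZ' hy) (hU.mem_nhds hy) h
  have e {W : Π y : M, TangentSpace 𝓘(ℝ, E) y} (hW : MDiffAt (T% W) x) :
      cov (fun y ↦ cov Z y (W y)) x = cov (fun y ↦ cov Z' y (W y)) x :=
    cov.isCovariantDerivativeOn.congr_of_eqOn (mdifferentiableAt_cov hU hZ hx hW)
      (mdifferentiableAt_cov hU hZ' hx hW) (hU.mem_nhds hx) fun y hy ↦ by rw [l y hy]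
  simp only [curvatureOp]
  rw [e hX, e hY, l x hx]

theorem curvatureOp_sum (hU : IsOpen U) (hx : x ∈ U) (hX : CMDiff[U] ∞ (T% X))
    (hY : CMDiff[U] ∞ (T% Y)) {ι : Type*} (s : Finset ι) {f : ι → M → ℝ}
    {W : ι → Π y : M, TangentSpace 𝓘(ℝ, E) y} (hf : ∀ i, CMDiff[U] ∞ (f i))
    (hW : ∀ i, CMDiff[U] ∞ (T% (W i))) :
    CMDiff[U] ∞ (T% (∑ i ∈ s, f i • W i)) ∧ curvatureOp cov X Y (∑ i ∈ s, f i • W i) x =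
      ∑ i ∈ s, f i x • curvatureOp cov X Y (W i) x := by
  classical
  have d {W : Π y : M, TangentSpace 𝓘(ℝ, E) y} (hW : CMDiff[U] ∞ (T% W)) :
      MDiffAt (T% W) x := ((hW x hx).contMDiffAt (hU.mem_nhds hx)).mdifferentiableAt (by simp)
  induction s using Finset.induction_on with
  | empty =>
    have h0 : CMDiff[U] ∞ (T% (0 : Π y : M, TangentSpace 𝓘(ℝ, E) y)) :=
      (contMDiff_zeroSection ℝ _).contMDiffOn
    have := curvatureOp_smul (cov := cov) hU hx hX hY h0 (f := fun _ ↦ 0) contMDiffOn_const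
    simp only [zero_smul, smul_zero] at this
    simp only [Finset.sum_empty]
    exact ⟨h0, this⟩
  | insert i s hi ih =>
    simp only [Finset.sum_insert hi]
    have h1 : CMDiff[U] ∞ (T% (f i • W i)) := (hf i).smul_section (hW i)
    refine ⟨h1.add_section ih.1, ?_⟩
    rw [curvatureOp_add hU hx (d hX) (d hY) h1 ih.1, curvatureOp_smul hU hx hX hY (hW i) (hf i),
      ih.2]

/-- `(R(X, Y) Z)(x)` depends on the values of `X`, `Y` and `Z` at `x` only. -/
theorem curvatureOp_pointwise (hU : IsOpen U) (hx : x ∈ U)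
    (hX : CMDiff[U] ∞ (T% X)) (hX' : CMDiff[U] ∞ (T% X')) (hXX' : X x = X' x)
    (hY : CMDiff[U] ∞ (T% Y)) (hY' : CMDiff[U] ∞ (T% Y')) (hYY' : Y x = Y' x)
    (hZ : CMDiff[U] ∞ (T% Z)) (hZ' : CMDiff[U] ∞ (T% Z')) (hZZ' : Z x = Z' x) :
    curvatureOp cov X Y Z x = curvatureOp cov X' Y' Z' x := by
  have d {V : Set M} (hV : IsOpen V) (hx : x ∈ V) {W : Π y : M, TangentSpace 𝓘(ℝ, E) y}
      (hW : CMDiff[V] ∞ (T% W)) : MDiffAt (T% W) x :=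
    ((hW x hx).contMDiffAt (hV.mem_nhds hx)).mdifferentiableAt (by simp)
  rw [(curvatureOp_tensorial_left hU hZ hx Y).pointwise (d hU hx hX) (d hU hx hX') hXX',
    (curvatureOp_tensorial_right hU hZ hx X').pointwise (d hU hx hY) (d hU hx hY') hYY']
  let e := trivializationAt E (TangentSpace 𝓘(ℝ, E) : M → Type _) x
  let b := Module.finBasis ℝ E
  have hxe : x ∈ e.baseSet := FiberBundle.mem_baseSet_trivializationAt' x
  have hV : IsOpen (U ∩ e.baseSet) := hU.inter e.open_baseSet
  have hxV : x ∈ U ∩ e.baseSet := ⟨hx, hxe⟩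
  have key {W : Π y : M, TangentSpace 𝓘(ℝ, E) y} (hW : CMDiff[U] ∞ (T% W)) :
      curvatureOp cov X' Y' W x = ∑ i, e.localFrameCoeff 𝓘(ℝ, E) b i x (W x) •
        curvatureOp cov X' Y' (e.localFrame b i) x := by
    have hW' := hW.mono (Set.inter_subset_left (t := e.baseSet))
    have s := curvatureOp_sum (cov := cov) hV hxV (hX'.mono Set.inter_subset_left)
      (hY'.mono Set.inter_subset_left) Finset.univ
      (f := fun i ↦ (LinearMap.piApply (e.localFrameCoeff 𝓘(ℝ, E) b i)) W)
      (W := fun i ↦ e.localFrame b i)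
      (fun i ↦ contMDiffOn_localFrameCoeff b hV Set.inter_subset_right hW' i)
      (fun i ↦ (e.contMDiffOn_localFrame_baseSet ∞ b i).mono Set.inter_subset_right)
    refine (curvatureOp_congr hV hxV (d hU hx hX') (d hU hx hY') hW' s.1 ?_).trans s.2
    intro y hy
    rw [e.eq_sum_localFrameCoeff_smul (I := 𝓘(ℝ, E)) (b := b) (s := W) hy.2]
    simp
  rw [key hZ, key hZ', hZZ']

theorem exists_contMDiffOn_extend_fin {m : ℕ} (v : Fin m → TangentSpace 𝓘(ℝ, E) x) :
    ∃ U : Set M, IsOpen U ∧ x ∈ U ∧ ∀ i, CMDiff[U] ∞ (T% (extend E (v i))) := by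
  choose s hs h using fun i ↦ exists_contMDiffOn_extend (k := ∞) 𝓘(ℝ, E) E (v i)
  obtain ⟨U, hU, hUo, hxU⟩ := mem_nhds_iff.1 (Filter.iInter_mem.2 hs)
  exact ⟨U, hUo, hxU, fun i ↦ (h i).mono (hU.trans (Set.iInter_subset _ i))⟩

theorem curvatureOp_extend (u v w a : TangentSpace 𝓘(ℝ, E) x) (c : ℝ) :
    curvatureOp cov (extend E (c • u + a)) (extend E v) (extend E w) x =
        c • curvatureOp cov (extend E u) (extend E v) (extend E w) x +
          curvatureOp cov (extend E a) (extend E v) (extend E w) x ∧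
      curvatureOp cov (extend E u) (extend E (c • v + a)) (extend E w) x =
        c • curvatureOp cov (extend E u) (extend E v) (extend E w) x +
          curvatureOp cov (extend E u) (extend E a) (extend E w) x ∧
      curvatureOp cov (extend E u) (extend E v) (extend E (c • w + a)) x =
        c • curvatureOp cov (extend E u) (extend E v) (extend E w) x +
          curvatureOp cov (extend E u) (extend E v) (extend E a) x := by
  obtain ⟨U, hU, hx, h⟩ :=
    exists_contMDiffOn_extend_fin ![u, v, w, a, c • u + a, c • v + a, c • w + a]
  have d {W : Π y : M, TangentSpace 𝓘(ℝ, E) y} (hW : CMDiff[U] ∞ (T% W)) :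
      MDiffAt (T% W) x := ((hW x hx).contMDiffAt (hU.mem_nhds hx)).mdifferentiableAt (by simp)
  have hu : CMDiff[U] ∞ (T% (extend E u)) := h 0
  have hv : CMDiff[U] ∞ (T% (extend E v)) := h 1
  have hw : CMDiff[U] ∞ (T% (extend E w)) := h 2
  have ha : CMDiff[U] ∞ (T% (extend E a)) := h 3
  have hc : MDiffAt (fun _ : M ↦ c) x := mdifferentiableAt_const
  have m {W : Π y : M, TangentSpace 𝓘(ℝ, E) y} (hW : CMDiff[U] ∞ (T% W)) :
      CMDiff[U] ∞ (T% ((fun _ : M ↦ c) • W)) := contMDiffOn_const.smul_section hW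
  have hl := curvatureOp_tensorial_left (cov := cov) hU hw hx (extend E v)
  have hr := curvatureOp_tensorial_right (cov := cov) hU hw hx (extend E u)
  refine ⟨?_, ?_, ?_⟩
  · rw [← hl.smul hc (d hu), ← hl.add (d (m hu)) (d ha)]
    exact curvatureOp_pointwise hU hx (h 4) ((m hu).add_section ha) (by simp) hv hv rfl hw hw rfl
  · rw [← hr.smul hc (d hv), ← hr.add (d (m hv)) (d ha)]
    exact curvatureOp_pointwise hU hx hu hu rfl (h 5) ((m hv).add_section ha) (by simp) hw hw rfl
  · rw [← curvatureOp_smul (f := fun _ ↦ c) hU hx hu hv hw contMDiffOn_const,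
      ← curvatureOp_add hU hx (d hu) (d hv) (m hw) ha]
    exact curvatureOp_pointwise hU hx hu hu rfl hv hv rfl (h 6) ((m hw).add_section ha) (by simp)

theorem curvatureOp_extend_zero (u v : TangentSpace 𝓘(ℝ, E) x) :
    curvatureOp cov (extend E (0 : TangentSpace 𝓘(ℝ, E) x)) (extend E u) (extend E v) x = 0 ∧
      curvatureOp cov (extend E u) (extend E (0 : TangentSpace 𝓘(ℝ, E) x)) (extend E v) x = 0 ∧
      curvatureOp cov (extend E u) (extend E v) (extend E (0 : TangentSpace 𝓘(ℝ, E) x)) x = 0 := by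
  refine ⟨?_, ?_, ?_⟩
  · simpa using (curvatureOp_extend (cov := cov) 0 u v 0 1).1
  · simpa using (curvatureOp_extend (cov := cov) u 0 v 0 1).2.1
  · simpa using (curvatureOp_extend (cov := cov) u v 0 0 1).2.2

variable (cov x) in
/-- The curvature of `cov` at `x`, as a trilinear map `(u, v, w) ↦ R(u, v) w`; see
`curvatureAt_apply`. -/
noncomputable def curvatureAt : MultilinearMap ℝ (fun _ : Fin 3 ↦ TangentSpace 𝓘(ℝ, E) x)
    (TangentSpace 𝓘(ℝ, E) x) where
  toFun v := curvatureOp cov (extend E (v 0)) (extend E (v 1)) (extend E (v 2)) x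
  map_update_add' {D} v i a b := by
    obtain rfl : D = instDecidableEqFin 3 := Subsingleton.elim _ _
    fin_cases i
    · simpa using (curvatureOp_extend (cov := cov) a (v 1) (v 2) b 1).1
    · simpa using (curvatureOp_extend (cov := cov) (v 0) a (v 2) b 1).2.1
    · simpa using (curvatureOp_extend (cov := cov) (v 0) (v 1) a b 1).2.2
  map_update_smul' {D} v i c a := by
    obtain rfl : D = instDecidableEqFin 3 := Subsingleton.elim _ _
    fin_cases i
    · have h := (curvatureOp_extend (cov := cov) a (v 1) (v 2) 0 c).1
      rw [(curvatureOp_extend_zero _ _).1, add_zero, add_zero] at h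
      simpa using h
    · have h := (curvatureOp_extend (cov := cov) (v 0) a (v 2) 0 c).2.1
      rw [(curvatureOp_extend_zero _ _).2.1, add_zero, add_zero] at h
      simpa using h
    · have h := (curvatureOp_extend (cov := cov) (v 0) (v 1) a 0 c).2.2
      rw [(curvatureOp_extend_zero _ _).2.2, add_zero, add_zero] at h
      simpa using h

/-- `R(X x, Y x) (Z x) = (R(X, Y) Z)(x)` for all vector fields smooth near `x`. -/
theorem curvatureAt_apply (hU : IsOpen U) (hx : x ∈ U) (hX : CMDiff[U] ∞ (T% X))
    (hY : CMDiff[U] ∞ (T% Y)) (hZ : CMDiff[U] ∞ (T% Z)) :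
    curvatureAt cov x ![X x, Y x, Z x] = curvatureOp cov X Y Z x := by
  obtain ⟨V, hV, hxV, h⟩ := exists_contMDiffOn_extend_fin ![X x, Y x, Z x]
  have l {W : Π y : M, TangentSpace 𝓘(ℝ, E) y} (hW : CMDiff[U] ∞ (T% W)) := hW.mono (Set.inter_subset_left (t := V))
  have r (i) := (h i).mono (Set.inter_subset_right (s := U))
  exact curvatureOp_pointwise (hU.inter hV) ⟨hx, hxV⟩ (r 0) (l hX) (by simp) (r 1) (l hY) (by simp)
    (r 2) (l hZ) (by simp)
variable (cov x) in
/-- The curvature tensor at `x`, with three covariant factors and one contravariant factor: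
`(u, v, w; α) ↦ α (R(u, v) w)`. -/
noncomputable def curvatureTensor : TensorSpace (TangentSpace 𝓘(ℝ, E) x) 3 1 :=
  (evalOne (TangentSpace 𝓘(ℝ, E) x)).compMultilinearMap (curvatureAt cov x)

theorem curvatureTensor_apply (u : Fin 3 → TangentSpace 𝓘(ℝ, E) x)
    (α : Fin 1 → Module.Dual ℝ (TangentSpace 𝓘(ℝ, E) x)) :
    curvatureTensor cov x u α = α 0 (curvatureAt cov x u) :=
  evalOne_apply _ _

end

end NullGeometry

namespace NullGeometry

open Bundle FiberBundle VectorField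

/-! ### Differentiating linear constraints on vector-valued functions -/

section Derivative

variable {E : Type*} [NormedAddCommGroup E] [NormedSpace ℝ E]
  {M : Type*} [TopologicalSpace M] [ChartedSpace E M]

/-! Two facts force the result: the curvature operators, read in a frame of `P`, lie in the Lie
algebra `gn` of `GN`, and they satisfy the first Bianchi identity.

For the first, Cartan's structure equation expresses `R(X, Y)` in a local section of `P` as `X(A(Y))
- Y(A(X)) + [A(X), A(Y)] - A([X, Y])`, with `A` the connection form. The equations of `IsInfNull`
hold on `gn`, are linear, and are stable under differentiation and commutators, so every curvature
operator satisfies them (`isInfNull_curvatureOp`).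

For the second part, give the covectors dual to `k`, `l`, `mᵢ` the weights `1`, `-1`, `0`, and the
component of `R(e_a, e_b) e_c` along `e_e` the weight `w(a) + w(b) + w(c) - w(e)`. Membership in
`gn` kills all components with `w(c) > w(e)`. Since `R` is skew in `a, b`, a surviving component of
positive weight has `{a, b} = {k, mᵢ}` and `w(c) = w(e)`. The Bianchi identity removes these: the
`kk` and `ll` entries directly, the `mm` entries because a three-index array symmetric in one pair
of indices and skew in an overlapping pair is zero (`curvature_component_eq_zero`).

Only components of weight at most `0` remain. Their basis tensors have total filtration level at
most `0`, and since the levels are nested they lie in boost order `0` (`pure_mem_boostOrder_zero`).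
-/

theorem mvfderiv_clm_comp {F G : Type*} [NormedAddCommGroup F] [NormedSpace ℝ F]
    [NormedAddCommGroup G] [NormedSpace ℝ G] (φ : F →L[ℝ] G) {f : M → F} {x : M}
    (hf : MDiffAt f x) (X : TangentSpace 𝓘(ℝ, E) x) :
    d% (fun y ↦ φ (f y)) x X = φ (d% f x X) := by
  have h := mfderiv_comp_apply (I := 𝓘(ℝ, E)) (I' := 𝓘(ℝ, F)) (I'' := 𝓘(ℝ, G)) (g := φ) (f := f)
    x φ.differentiableAt.mdifferentiableAt hf X
  rw [ContinuousLinearMap.mfderiv_eq] at h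
  exact h

/-- Each equation defining `gn` has at most two terms, each a fixed functional of one value `A w`.
This is the form in which such an equation passes to the derivative of `A`. -/
theorem mvfderiv_clm_add_clm_eq_zero {F : Type*} [NormedAddCommGroup F] [NormedSpace ℝ F]
    (φ ψ : F →L[ℝ] ℝ) {f g : M → F} {x : M}
    (hf : MDiffAt f x) (hg : MDiffAt g x) (h : ∀ᶠ y in 𝓝 x, φ (f y) + ψ (g y) = 0)
    (X : TangentSpace 𝓘(ℝ, E) x) : φ (d% f x X) + ψ (d% g x X) = 0 := by
  have hφ : MDiffAt (fun y ↦ φ (f y)) x := φ.differentiableAt.mdifferentiableAt.comp x hf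
  have hψ : MDiffAt (fun y ↦ ψ (g y)) x := ψ.differentiableAt.mdifferentiableAt.comp x hg
  have e := congr($(mvfderiv_add hφ hψ) X)
  rw [add_apply, mvfderiv_clm_comp φ hf, mvfderiv_clm_comp ψ hg] at e
  rw [← e]
  have h' : (fun y ↦ φ (f y)) + (fun y ↦ ψ (g y)) =ᶠ[𝓝 x] fun _ ↦ 0 := h
  have := congr($(h'.mfderiv_eq (I := 𝓘(ℝ, E)) (I' := 𝓘(ℝ, ℝ))) X)
  refine Eq.trans this ?_
  rw [mfderiv_const]
  rfl

end Derivative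

/-! ### Smooth frames, Cartan's structure equation, Bianchi identity -/

section Frames

variable {E : Type*} [NormedAddCommGroup E] [NormedSpace ℝ E] [FiniteDimensional ℝ E]
  {M : Type*} [TopologicalSpace M] [T2Space M] [ChartedSpace E M] [IsManifold 𝓘(ℝ, E) ∞ M]

/-- The coefficients of a differentiable vector field in a smooth frame are differentiable. -/
theorem IsSmoothFrameOn.mdifferentiableAt_symm_apply
    {s : (y : M) → (E ≃L[ℝ] TangentSpace 𝓘(ℝ, E) y)} {U : Set M} (hs : IsSmoothFrameOn s U)
    (hU : IsOpen U) {x : M} (hx : x ∈ U) {W : Π y : M, TangentSpace 𝓘(ℝ, E) y}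
    (hW : MDiffAt (T% W) x) : MDiffAt (fun y ↦ (s y).symm (W y)) x := by
  let e := trivializationAt E (TangentSpace 𝓘(ℝ, E) : M → Type _) x
  have hxe : x ∈ e.baseSet := FiberBundle.mem_baseSet_trivializationAt' x
  let b := Module.finBasis ℝ E
  -- `Φ y` is the frame read in the trivialization. As a sum of rank-one maps it is defined for all
  -- `y`, and it inherits differentiability from the frame fields `s y (b j)`. The coefficients of
  -- `W` are then `Φ⁻¹` applied to the trivialized `W`.
  let Φ : M → E →L[ℝ] E := fun y ↦
    ∑ j, (b.coord j).toContinuousLinearMap.smulRight (e ⟨y, s y (b j)⟩).2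
  have hΦ (y : M) (hy : y ∈ e.baseSet) :
      Φ y = ((s y).trans (e.continuousLinearEquivAt ℝ y hy) : E →L[ℝ] E) := by
    refine ContinuousLinearMap.coe_injective (b.ext fun i ↦ ?_)
    simp [Φ, Finsupp.single_apply]
  have hΦd : MDiffAt Φ x := by
    have h (j) : MDiffAt (fun y ↦ (e ⟨y, s y (b j)⟩).2) x :=
      (mdifferentiableAt_section 𝓘(ℝ, E) (fun y ↦ s y (b j))).1
        ((((hs (b j)) x hx).contMDiffAt (hU.mem_nhds hx)).mdifferentiableAt (by simp))
    have h' (j) : MDiffAt (fun y ↦ (b.coord j).toContinuousLinearMap.smulRight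
        (e ⟨y, s y (b j)⟩).2) x :=
      (ContinuousLinearMap.smulRightL ℝ E E
        (b.coord j).toContinuousLinearMap).differentiableAt.mdifferentiableAt.comp x (h j)
    have e : Φ = ∑ j, fun y ↦ (b.coord j).toContinuousLinearMap.smulRight
        (e ⟨y, s y (b j)⟩).2 := by
      ext1 y
      simp [Φ]
    rw [e]
    exact MDifferentiableAt.sum fun j _ ↦ h' j
  have hinv : MDiffAt (fun y ↦ (Φ y).inverse) x := by
    refine MDifferentiableAt.comp x (g := ContinuousLinearMap.inverse) ?_ hΦd
    rw [hΦ x hxe]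
    exact ((contDiffAt_map_inverse (n := 1) _).differentiableAt one_ne_zero).mdifferentiableAt
  have hWe := (mdifferentiableAt_section 𝓘(ℝ, E) W).1 hW
  refine (hinv.clm_apply hWe).congr_of_eventuallyEq ?_
  filter_upwards [e.open_baseSet.mem_nhds hxe] with y hy
  rw [hΦ y hy, ContinuousLinearMap.inverse_equiv]
  change _ = (s y).symm ((e.continuousLinearEquivAt ℝ y hy).symm _)
  rw [ContinuousLinearEquiv.eq_symm_apply, ContinuousLinearEquiv.apply_symm_apply,
    ContinuousLinearEquiv.eq_symm_apply]
  simp [e]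

variable {cov : CovariantDerivative 𝓘(ℝ, E) E (TangentSpace 𝓘(ℝ, E) : M → Type _)}

theorem cov_sum {ι : Type*} (t : Finset ι) {x : M} {W : ι → Π y : M, TangentSpace 𝓘(ℝ, E) y}
    (hW : ∀ i, MDiffAt (T% (W i)) x) :
    MDiffAt (T% (∑ i ∈ t, W i)) x ∧ cov (∑ i ∈ t, W i) x = ∑ i ∈ t, cov (W i) x := by
  classical
  induction t using Finset.induction_on with
  | empty =>
    simp only [Finset.sum_empty, cov.isCovariantDerivativeOnUniv.zero, and_true]
    exact mdifferentiableAt_zeroSection ..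
  | insert i t hi ih =>
    simp only [Finset.sum_insert hi]
    exact ⟨mdifferentiableAt_add_section (hW i) ih.1,
      by rw [cov.isCovariantDerivativeOnUniv.add (hW i) ih.1, ih.2]⟩

/-- The covariant derivative of a field with differentiable coefficients in a smooth frame. -/
theorem IsSmoothFrameOn.cov_apply {s : (y : M) → (E ≃L[ℝ] TangentSpace 𝓘(ℝ, E) y)} {U : Set M}
    (hs : IsSmoothFrameOn s U) (hU : IsOpen U) {x : M} (hx : x ∈ U) {f : M → E}
    (hf : MDiffAt f x) (X : TangentSpace 𝓘(ℝ, E) x) {A : E →L[ℝ] E}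
    (hA : ∀ v, cov (fun z ↦ s z v) x X = s x (A v)) :
    cov (fun z ↦ s z (f z)) x X = s x (d% f x X + A (f x)) := by
  let b := Module.finBasis ℝ E
  have hb (v : E) : v = ∑ i, b.coord i v • b i := by simp [b.sum_repr]
  have hfi (i) : MDiffAt (fun y ↦ b.coord i (f y)) x :=
    (b.coord i).toContinuousLinearMap.differentiableAt.mdifferentiableAt.comp x hf
  have hdf (i) : d% (fun y ↦ b.coord i (f y)) x X = b.coord i (d% f x X) :=
    mvfderiv_clm_comp (b.coord i).toContinuousLinearMap hf X
  have hsi (i) : MDiffAt (T% (fun z ↦ s z (b i))) x :=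
    (((hs (b i)) x hx).contMDiffAt (hU.mem_nhds hx)).mdifferentiableAt (by simp)
  -- Expanding `f` in a fixed basis leaves functions times frame fields with constant coefficients,
  -- to which the Leibniz rule and `hA` apply.
  have e : (fun z ↦ s z (f z)) = ∑ i, (fun z ↦ b.coord i (f z)) • fun z ↦ s z (b i) := by
    ext1 z
    conv_lhs => rw [hb (f z), map_sum]
    simp
  rw [e, (cov_sum Finset.univ fun i ↦ (hfi i).smul_section (hsi i)).2]
  rw [hb (d% f x X + A (f x))]
  simp only [cov.isCovariantDerivativeOnUniv.leibniz (hsi _) (hfi _),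
    sum_apply, add_apply, smul_apply, ContinuousLinearMap.smulRight_apply,
    hA, hdf, map_sum, map_smul, map_add, add_smul, Finset.sum_add_distrib]
  rw [add_comm]
  congr 1
  simp only [← map_smul, ← map_sum, ← hb]

/-- The curvature operator in a smooth frame, by Cartan's structure equation. -/
theorem IsSmoothFrameOn.curvatureOp_apply
    [CovariantDerivative.ContMDiffCovariantDerivative cov ∞]
    {s : (y : M) → (E ≃L[ℝ] TangentSpace 𝓘(ℝ, E) y)} {U : Set M} (hs : IsSmoothFrameOn s U)
    (hU : IsOpen U) {x : M} (hx : x ∈ U) {X Y : Π y : M, TangentSpace 𝓘(ℝ, E) y}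
    (hX : CMDiff[U] ∞ (T% X)) (hY : CMDiff[U] ∞ (T% Y))
    {A : (y : M) → TangentSpace 𝓘(ℝ, E) y → E →L[ℝ] E}
    (hA : ∀ y ∈ U, ∀ W v, cov (fun z ↦ s z v) y W = s y (A y W v)) (v : E) :
    (MDiffAt (fun y ↦ A y (X y) v) x ∧ MDiffAt (fun y ↦ A y (Y y) v) x) ∧
    curvatureOp cov X Y (fun z ↦ s z v) x =
      s x (d% (fun y ↦ A y (Y y) v) x (X x) + A x (X x) (A x (Y x) v)
        - (d% (fun y ↦ A y (X y) v) x (Y x) + A x (Y x) (A x (X x) v))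
        - A x (mlieBracket 𝓘(ℝ, E) X Y x) v) := by
  have d {W : Π y : M, TangentSpace 𝓘(ℝ, E) y} (hW : CMDiff[U] ∞ (T% W)) :
      MDiffAt (T% W) x := ((hW x hx).contMDiffAt (hU.mem_nhds hx)).mdifferentiableAt (by simp)
  -- No regularity of `A` is assumed: `A y (W y) v` is the coefficient vector of `∇_W (s v)` in the
  -- frame, and differentiability comes from there.
  have m {W : Π y : M, TangentSpace 𝓘(ℝ, E) y} (hW : CMDiff[U] ∞ (T% W)) :
      MDiffAt (fun y ↦ A y (W y) v) x := by
    refine (hs.mdifferentiableAt_symm_apply hU hx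
      (mdifferentiableAt_cov (cov := cov) hU (hs v) hx (d hW))).congr_of_eventuallyEq ?_
    filter_upwards [hU.mem_nhds hx] with y hy
    rw [hA y hy, ContinuousLinearEquiv.symm_apply_apply]
  have c {V W : Π y : M, TangentSpace 𝓘(ℝ, E) y} (hW : CMDiff[U] ∞ (T% W)) :
      cov (fun y ↦ cov (fun z ↦ s z v) y (W y)) x (V x) =
        s x (d% (fun y ↦ A y (W y) v) x (V x) + A x (V x) (A x (W x) v)) := by
    rw [← hs.cov_apply hU hx (m hW) (V x) (hA x hx (V x))]
    congr 1
    have h1 := mdifferentiableAt_cov (cov := cov) hU (hs v) hx (d hW)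
    have e : ∀ᶠ y in 𝓝 x, s y (A y (W y) v) = cov (fun z ↦ s z v) y (W y) := by
      filter_upwards [hU.mem_nhds hx] with y hy
      rw [hA y hy]
    refine cov.isCovariantDerivativeOn.congr_of_eventuallyEq (s := Set.univ) h1
      (h1.congr_of_eventuallyEq ?_) Filter.univ_mem (e.mono fun _ h ↦ h.symm)
    filter_upwards [e] with y hy
    rw [hy]
  refine ⟨⟨m hX, m hY⟩, ?_⟩
  rw [curvatureOp, c hY, c hX, hA x hx, map_sub, map_sub]

/-- The first Bianchi identity of a torsion-free connection. -/
theorem curvatureOp_bianchi [CovariantDerivative.ContMDiffCovariantDerivative cov ∞]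
    (htorsion : cov.torsion = 0) {X Y Z : Π y : M, TangentSpace 𝓘(ℝ, E) y} {U : Set M}
    (hU : IsOpen U) {x : M} (hx : x ∈ U) (hX : CMDiff[U] ∞ (T% X)) (hY : CMDiff[U] ∞ (T% Y))
    (hZ : CMDiff[U] ∞ (T% Z)) :
    curvatureOp cov X Y Z x + curvatureOp cov Y Z X x + curvatureOp cov Z X Y x = 0 := by
  have a {W : Π y : M, TangentSpace 𝓘(ℝ, E) y} (hW : CMDiff[U] ∞ (T% W)) {y : M} (hy : y ∈ U) :
      CMDiffAt ∞ (T% W) y := (hW y hy).contMDiffAt (hU.mem_nhds hy)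
  have d {W : Π y : M, TangentSpace 𝓘(ℝ, E) y} (hW : CMDiff[U] ∞ (T% W)) {y : M} (hy : y ∈ U) :
      MDiffAt (T% W) y := (a hW hy).mdifferentiableAt (by simp)
  have two : minSmoothness ℝ 2 ≤ (∞ : ℕ∞ω) := by
    rw [minSmoothness_of_isRCLikeNormedField]; exact ENat.LEInfty.out
  have two' : IsManifold 𝓘(ℝ, E) (minSmoothness ℝ 2) M := IsManifold.of_le two
  have three' : IsManifold 𝓘(ℝ, E) (minSmoothness ℝ 3) M := by
    refine IsManifold.of_le (n := ∞) ?_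
    rw [minSmoothness_of_isRCLikeNormedField]; exact ENat.LEInfty.out
  have three'' : IsManifold 𝓘(ℝ, E) (((2 : ℕ∞) : ℕ∞ω) + 1) M :=
    IsManifold.of_le (n := ∞) (by norm_cast)
  have tor {V W : Π y : M, TangentSpace 𝓘(ℝ, E) y} {y : M} (hV : MDiffAt (T% V) y)
      (hW : MDiffAt (T% W) y) := cov.torsion_eq_zero_iff.1 htorsion hV hW
  have br {V W : Π y : M, TangentSpace 𝓘(ℝ, E) y} (hV : CMDiff[U] ∞ (T% V))
      (hW : CMDiff[U] ∞ (T% W)) : MDiffAt (T% (mlieBracket 𝓘(ℝ, E) V W)) x :=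
    (((a hV hx).of_le ENat.LEInfty.out).mlieBracket_vectorField (m := 1) (n := 2)
      ((a hW hx).of_le ENat.LEInfty.out) (by
        rw [minSmoothness_of_isRCLikeNormedField]; norm_num [one_add_one_eq_two])).mdifferentiableAt
        one_ne_zero
  -- Vanishing torsion gives `∇_V W = ∇_W V + [V, W]` near `x`, and this may be differentiated once
  -- more.
  have key {V W : Π y : M, TangentSpace 𝓘(ℝ, E) y} (hV : CMDiff[U] ∞ (T% V))
      (hW : CMDiff[U] ∞ (T% W)) : cov (fun y ↦ cov W y (V y)) x =
        cov (fun y ↦ cov V y (W y)) x + cov (mlieBracket 𝓘(ℝ, E) V W) x := by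
    have m := mdifferentiableAt_cov (cov := cov) hU hV hx (d hW hx)
    rw [← cov.isCovariantDerivativeOnUniv.add m (br hV hW)]
    refine cov.isCovariantDerivativeOn.congr_of_eventuallyEq (s := Set.univ)
      (mdifferentiableAt_cov hU hW hx (d hV hx)) (mdifferentiableAt_add_section m (br hV hW))
      Filter.univ_mem ?_
    filter_upwards [hU.mem_nhds hx] with y hy
    rw [Pi.add_apply, ← tor (d hV hy) (d hW hy)]
    abel
  -- After `key`, what is left of the cyclic sum is `∇_X [Y, Z] - ∇_[Y,Z] X` and its cyclic images.
  -- Vanishing torsion turns these into double brackets, whose sum is zero by Jacobi.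
  have t1 := tor (d hX hx) (br hY hZ)
  have t2 := tor (d hY hx) (br hZ hX)
  have t3 := tor (d hZ hx) (br hX hY)
  have J := leibniz_identity_mlieBracket_apply ((a hX hx).of_le two) ((a hY hx).of_le two)
    ((a hZ hx).of_le two)
  -- The Jacobi identity `J` has Leibniz form; `s1` and `s2` bring it to cyclic form.
  have s1 : mlieBracket 𝓘(ℝ, E) (mlieBracket 𝓘(ℝ, E) X Y) Z x =
      - mlieBracket 𝓘(ℝ, E) Z (mlieBracket 𝓘(ℝ, E) X Y) x := mlieBracket_swap_apply
  have s2 : mlieBracket 𝓘(ℝ, E) Y (mlieBracket 𝓘(ℝ, E) X Z) x =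
      - mlieBracket 𝓘(ℝ, E) Y (mlieBracket 𝓘(ℝ, E) Z X) x := by
    rw [show mlieBracket 𝓘(ℝ, E) X Z = (-1 : ℝ) • mlieBracket 𝓘(ℝ, E) Z X by
      rw [mlieBracket_swap, neg_one_smul], mlieBracket_const_smul_right (br hZ hX), neg_one_smul]
  rw [s1, s2, ← t1, ← t2, ← t3] at J
  simp only [curvatureOp]
  rw [key hY hZ, key hZ hX, key hX hY]
  simp only [add_apply]
  rw [← sub_eq_zero] at J
  refine Eq.trans ?_ J
  abel

end Frames
-- The Lie algebra of `GN` as a system of linear equations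
section NullAlgebra

variable {d : ℕ}

/-- The linear equations that cut out the Lie algebra of `GN` among all endomorphisms. -/
structure IsInfNull (A : EuclideanSpace ℝ (Fin (d + 2)) → EuclideanSpace ℝ (Fin (d + 2))) :
    Prop where
  map_nullVec : ∀ i ≠ 0, A (nullVec d) i = 0
  null : ∀ w, A w 1 = - (A (nullVec d) 0 * w 1)
  perp : ∀ w w', w 1 = 0 → w' 1 = 0 → minkowski (A w) w' + minkowski w (A w') = 0

theorem minkowski_nullVec_left (w : EuclideanSpace ℝ (Fin (d + 2))) :
    minkowski (nullVec d) w = w 1 := by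
  simp [minkowski, nullVec, Fin.ext_iff]

theorem mem_nullPerp {w : EuclideanSpace ℝ (Fin (d + 2))} : w ∈ nullPerp d ↔ w 1 = 0 := by
  rw [← minkowski_nullVec_left]
  rfl

theorem minkowski_add_right (w v v' : EuclideanSpace ℝ (Fin (d + 2))) :
    minkowski w (v + v') = minkowski w v + minkowski w v' := by
  simp only [minkowski_comm w, minkowski_add_left]

theorem minkowski_smul_right (a : ℝ) (v w : EuclideanSpace ℝ (Fin (d + 2))) :
    minkowski v (a • w) = a * minkowski v w := by
  simp only [minkowski_comm v, minkowski_smul_left]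

theorem minkowski_sub_left (v v' w : EuclideanSpace ℝ (Fin (d + 2))) :
    minkowski (v - v') w = minkowski v w - minkowski v' w := by
  rw [sub_eq_add_neg, ← neg_one_smul ℝ v', minkowski_add_left, minkowski_smul_left]
  ring

theorem minkowski_sub_right (w v v' : EuclideanSpace ℝ (Fin (d + 2))) :
    minkowski w (v - v') = minkowski w v - minkowski w v' := by
  simp only [minkowski_comm w, minkowski_sub_left]

/-- The Minkowski inner product with a fixed vector as a continuous linear functional. -/
noncomputable def minkowskiCLM (w : EuclideanSpace ℝ (Fin (d + 2))) :
    EuclideanSpace ℝ (Fin (d + 2)) →L[ℝ] ℝ :=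
  LinearMap.toContinuousLinearMap
    { toFun := minkowski w
      map_add' := minkowski_add_right w
      map_smul' := fun a v ↦ minkowski_smul_right a w v }

theorem minkowskiCLM_apply (w v : EuclideanSpace ℝ (Fin (d + 2))) :
    minkowskiCLM w v = minkowski w v := rfl

theorem hasDerivAt_minkowski {f g : ℝ → EuclideanSpace ℝ (Fin (d + 2))}
    {f' g' : EuclideanSpace ℝ (Fin (d + 2))} {t : ℝ} (hf : HasDerivAt f f' t)
    (hg : HasDerivAt g g' t) :
    HasDerivAt (fun u ↦ minkowski (f u) (g u)) (minkowski f' (g t) + minkowski (f t) g') t := by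
  have hf' (i) : HasDerivAt (fun u ↦ f u i) (f' i) t :=
    (EuclideanSpace.proj (𝕜 := ℝ) i).hasFDerivAt.comp_hasDerivAt t hf
  have hg' (i) : HasDerivAt (fun u ↦ g u i) (g' i) t :=
    (EuclideanSpace.proj (𝕜 := ℝ) i).hasFDerivAt.comp_hasDerivAt t hg
  have h := (((hf' 0).fun_mul (hg' 1)).fun_add ((hf' 1).fun_mul (hg' 0))).fun_add
    (HasDerivAt.fun_sum (u := Finset.univ) fun (i : Fin d) _ ↦
      (hf' i.succ.succ).fun_mul (hg' i.succ.succ))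
  refine h.congr_deriv ?_
  simp only [minkowski, Finset.sum_add_distrib]
  ring

theorem eq_smul_nullVec {v : EuclideanSpace ℝ (Fin (d + 2))} (h : ∀ i ≠ 0, v i = 0) :
    v = v 0 • nullVec d := by
  ext i
  by_cases hi : i = 0
  · subst hi
    simp [nullVec]
  · rw [h i hi]
    simp [nullVec, hi]

theorem IsInfNull.map_nullVec_eq
    {A : EuclideanSpace ℝ (Fin (d + 2)) → EuclideanSpace ℝ (Fin (d + 2))} (hA : IsInfNull A) :
    A (nullVec d) = A (nullVec d) 0 • nullVec d :=
  eq_smul_nullVec hA.map_nullVec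

/-- The defining conditions of `GN` hold along the curve `exp (t A)`; differentiating them at `t =
0` gives the linear equations for `A`. -/
theorem isInfNull_of_mem_linearLieAlgebra
    {A : EuclideanSpace ℝ (Fin (d + 2)) →L[ℝ] EuclideanSpace ℝ (Fin (d + 2))}
    (hA : A ∈ linearLieAlgebra (GN d)) : IsInfNull A := by
  have h0 (v) : NormedSpace.exp ((0 : ℝ) • A) v = v := by
    refine (congrArg (fun B : EuclideanSpace ℝ (Fin (d + 2)) →L[ℝ] EuclideanSpace ℝ (Fin (d + 2)) ↦
      NormedSpace.exp B v) (zero_smul ℝ A)).trans ?_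
    rw [NormedSpace.exp_zero]
    rfl
  have hd (v) : HasDerivAt (fun t : ℝ ↦ NormedSpace.exp (t • A) v) (A v) 0 := by
    have h := (hasDerivAt_exp_smul_const A (0 : ℝ)).clm_apply (hasDerivAt_const (0 : ℝ) v)
    simpa [h0] using h
  have hG (t : ℝ) : ∃ g : EuclideanSpace ℝ (Fin (d + 2)) ≃L[ℝ] EuclideanSpace ℝ (Fin (d + 2)),
      PreservesNull g ∧ ∀ v, NormedSpace.exp (t • A) v = g v := by
    obtain ⟨g, hg, h⟩ := hA t
    exact ⟨g, hg, fun v ↦ by rw [← h]; rfl⟩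
  have e0 : ∀ i ≠ 0, A (nullVec d) i = 0 := by
    intro i hi
    have h : HasDerivAt (fun t : ℝ ↦ NormedSpace.exp (t • A) (nullVec d) i) (A (nullVec d) i) 0 :=
      (EuclideanSpace.proj (𝕜 := ℝ) i).hasFDerivAt.comp_hasDerivAt 0 (hd _)
    refine h.unique ((hasDerivAt_const (0 : ℝ) (0 : ℝ)).congr_of_eventuallyEq
      (Filter.Eventually.of_forall fun t ↦ ?_))
    obtain ⟨g, hg, h⟩ := hG t
    obtain ⟨a, -, ha⟩ := hg.exists_smul
    simp only [h, ha]
    simp [nullVec, hi]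
  have em (v w) (h : ∀ t : ℝ, minkowski (NormedSpace.exp (t • A) v) (NormedSpace.exp (t • A) w) =
      minkowski v w) : minkowski (A v) w + minkowski v (A w) = 0 := by
    have h1 := hasDerivAt_minkowski (hd v) (hd w)
    rw [h0, h0, funext h] at h1
    exact h1.unique (hasDerivAt_const _ _)
  refine ⟨e0, fun w ↦ ?_, fun w w' hw hw' ↦ em w w' fun t ↦ ?_⟩
  -- The derivative is `η(A k, w) + η(k, A w) = 0`, and `A k` is a multiple of `k`, while `η(k, ·)`
  -- is the `l`-coordinate.
  · have h := em (nullVec d) w fun t ↦ by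
      obtain ⟨g, hg, h⟩ := hG t
      rw [h, h, hg.null]
    rw [eq_smul_nullVec e0, minkowski_smul_left, minkowski_nullVec_left, minkowski_nullVec_left] at h
    linarith
  · obtain ⟨g, hg, h⟩ := hG t
    rw [h, h, hg.perp w (mem_nullPerp.2 hw) w' (mem_nullPerp.2 hw')]

/-- The equations are linear in `A`. They are imposed on bare maps, so that a combination of
derivatives of connection forms needs no separate proof of linearity. -/
theorem IsInfNull.sub {A B : EuclideanSpace ℝ (Fin (d + 2)) → EuclideanSpace ℝ (Fin (d + 2))}
    (hA : IsInfNull A) (hB : IsInfNull B) : IsInfNull fun v ↦ A v - B v where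
  map_nullVec i hi := by simp [hA.map_nullVec i hi, hB.map_nullVec i hi]
  null w := by
    simp only [PiLp.sub_apply, hA.null w, hB.null w]
    ring
  perp w w' hw hw' := by
    have h1 := hA.perp w w' hw hw'
    have h2 := hB.perp w w' hw hw'
    rw [minkowski_sub_left, minkowski_sub_right]
    linarith

theorem IsInfNull.add {A B : EuclideanSpace ℝ (Fin (d + 2)) → EuclideanSpace ℝ (Fin (d + 2))}
    (hA : IsInfNull A) (hB : IsInfNull B) : IsInfNull fun v ↦ A v + B v where
  map_nullVec i hi := by simp [hA.map_nullVec i hi, hB.map_nullVec i hi]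
  null w := by
    simp only [PiLp.add_apply, hA.null w, hB.null w]
    ring
  perp w w' hw hw' := by
    have h1 := hA.perp w w' hw hw'
    have h2 := hB.perp w w' hw hw'
    rw [minkowski_add_left, minkowski_add_right]
    linarith

/-- `A` and `B` both scale `k`, so the commutator kills `k`. Both preserve `{k}^⊥` and are skew for
`η` there, and commutators of skew maps are skew. -/
theorem IsInfNull.commutator
    {A B : EuclideanSpace ℝ (Fin (d + 2)) →L[ℝ] EuclideanSpace ℝ (Fin (d + 2))}
    (hA : IsInfNull A) (hB : IsInfNull B) : IsInfNull fun v ↦ A (B v) - B (A v) := by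
  have hk : A (B (nullVec d)) - B (A (nullVec d)) = 0 := by
    rw [hB.map_nullVec_eq, hA.map_nullVec_eq, map_smul, map_smul, hA.map_nullVec_eq,
      hB.map_nullVec_eq, smul_smul, smul_smul]
    simp [nullVec, mul_comm]
  refine ⟨fun i _ ↦ by simp [hk], fun w ↦ ?_, fun w w' hw hw' ↦ ?_⟩
  · rw [hk]
    simp only [PiLp.sub_apply, hA.null (B w), hB.null w, hB.null (A w), hA.null w]
    simp
    ring
  · have a1 {w} (h : w 1 = 0) : A w 1 = 0 := by rw [hA.null, h]; simp
    have b1 {w} (h : w 1 = 0) : B w 1 = 0 := by rw [hB.null, h]; simp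
    rw [minkowski_sub_left, minkowski_sub_right]
    have h1 := hA.perp (B w) w' (b1 hw) hw'
    have h2 := hA.perp w (B w') hw (b1 hw')
    have h3 := hB.perp (A w) w' (a1 hw) hw'
    have h4 := hB.perp w (A w') hw (a1 hw')
    linarith

variable {M : Type*} [TopologicalSpace M]
  [ChartedSpace (EuclideanSpace ℝ (Fin (d + 2))) M]

/-- A derivative of a family of elements of the Lie algebra of `GN` is in the Lie algebra. -/
theorem isInfNull_mvfderiv
    {A : M → EuclideanSpace ℝ (Fin (d + 2)) → EuclideanSpace ℝ (Fin (d + 2))} {x : M}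
    (hA : ∀ᶠ y in 𝓝 x, IsInfNull (A y))
    (hd : ∀ v, MDifferentiableAt (𝓡 (d + 2)) 𝓘(ℝ, EuclideanSpace ℝ (Fin (d + 2)))
      (fun y ↦ A y v) x)
    (X : TangentSpace (𝓡 (d + 2)) x) :
    IsInfNull fun v ↦ mvfderiv (𝓡 (d + 2)) (fun y ↦ A y v) x X where
  map_nullVec i hi := by
    -- This equation has a single term, so the second functional is `0`.
    have h := mvfderiv_clm_add_clm_eq_zero (EuclideanSpace.proj (𝕜 := ℝ) i) 0 (hd (nullVec d))
      (hd 0) (hA.mono fun y h ↦ by simp [h.map_nullVec i hi]) X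
    simpa using h
  null w := by
    have h := mvfderiv_clm_add_clm_eq_zero (EuclideanSpace.proj (𝕜 := ℝ) 1)
      (w 1 • EuclideanSpace.proj (𝕜 := ℝ) 0) (hd w)
      (hd (nullVec d)) (hA.mono fun y h ↦ by simp [h.null w, mul_comm]) X
    rw [eq_neg_iff_add_eq_zero, mul_comm]
    exact h
  perp w w' hw hw' := by
    have h := mvfderiv_clm_add_clm_eq_zero (minkowskiCLM w') (minkowskiCLM w) (hd w)
      (hd w') (hA.mono fun y h ↦ by
        rw [minkowskiCLM_apply, minkowskiCLM_apply, minkowski_comm w', h.perp w w' hw hw']) X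
    rw [minkowskiCLM_apply, minkowskiCLM_apply, minkowski_comm w'] at h
    exact h

end NullAlgebra

/-! ### Curvature operators lie in the Lie algebra -/

section Curvature

variable {d : ℕ} {M : Type*} [TopologicalSpace M] [T2Space M]
  [ChartedSpace (EuclideanSpace ℝ (Fin (d + 2))) M] [IsManifold (𝓡 (d + 2)) ∞ M]
  {cov : CovariantDerivative (𝓡 (d + 2)) (EuclideanSpace ℝ (Fin (d + 2)))
      (TangentSpace (𝓡 (d + 2)) : M → Type _)}
  [cov.ContMDiffCovariantDerivative ∞]

/-- In a frame of a `GN`-structure, the curvature operators of a connection belonging to the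
structure are elements of the Lie algebra of `GN`. -/
theorem isInfNull_curvatureOp {P : GStructure M (GN d)} (hP : P.IsConnectionIn cov) {U : Set M}
    (hU : IsOpen U) {s : (y : M) → (EuclideanSpace ℝ (Fin (d + 2)) ≃L[ℝ]
      TangentSpace (𝓡 (d + 2)) y)} (hs : IsSmoothFrameOn s U) (hsP : ∀ y ∈ U, s y ∈ P.frames y)
    {x : M} (hx : x ∈ U) {X Y : Π y : M, TangentSpace (𝓡 (d + 2)) y}
    (hX : ContMDiffOn (𝓡 (d + 2)) (𝓡 (d + 2)).tangent ∞ (T% X) U)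
    (hY : ContMDiffOn (𝓡 (d + 2)) (𝓡 (d + 2)).tangent ∞ (T% Y) U) :
    IsInfNull fun v ↦ (s x).symm (curvatureOp cov X Y (fun z ↦ s z v) x) := by
  -- A pointwise choice of connection form, with the default `0` off `U`.
  have hA : ∀ y W, ∃ A : EuclideanSpace ℝ (Fin (d + 2)) →L[ℝ] EuclideanSpace ℝ (Fin (d + 2)),
      y ∈ U → IsInfNull A ∧ ∀ v, cov (fun z ↦ s z v) y W = s y (A v) := by
    intro y W
    by_cases hy : y ∈ U
    · obtain ⟨A, hA, h⟩ := hP U s hU hs hsP y hy W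
      exact ⟨A, fun _ ↦ ⟨isInfNull_of_mem_linearLieAlgebra hA, h⟩⟩
    · exact ⟨0, fun h ↦ absurd h hy⟩
  choose A hA using hA
  have h := fun v ↦ hs.curvatureOp_apply hU hx hX hY (A := A) (fun y hy W ↦ (hA y W hy).2) v
  have near (W : Π y : M, TangentSpace (𝓡 (d + 2)) y) : ∀ᶠ y in 𝓝 x, IsInfNull (A y (W y)) := by
    filter_upwards [hU.mem_nhds hx] with y hy
    exact (hA y _ hy).1
  -- One summand for each term of the structure equation: the two derivatives, the commutator, and
  -- the value on `[X, Y]`.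
  have key := (((isInfNull_mvfderiv (near Y) (fun v ↦ (h v).1.2) (X x)).sub
    (isInfNull_mvfderiv (near X) (fun v ↦ (h v).1.1) (Y x))).add
    (((hA x (X x) hx).1).commutator (hA x (Y x) hx).1)).sub
    (hA x (mlieBracket (𝓡 (d + 2)) X Y x) hx).1
  convert key using 2 with v
  rw [(h v).2, ContinuousLinearEquiv.symm_apply_apply]
  abel

end Curvature

/-! ### Weights of curvature components and boost order -/

section Algebra

variable {d : ℕ}

/-- The `mᵢ` are `η`-orthonormal vectors of `{k}^⊥`, so `η(·, mⱼ)` reads off the `mⱼ`-coordinate and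
`perp` becomes skew-symmetry of the `mm` block. -/
theorem IsInfNull.skew {A : EuclideanSpace ℝ (Fin (d + 2)) → EuclideanSpace ℝ (Fin (d + 2))}
    (hA : IsInfNull A) (i j : Fin d) :
    A (EuclideanSpace.single i.succ.succ 1) j.succ.succ =
      - A (EuclideanSpace.single j.succ.succ 1) i.succ.succ := by
  have h (k : Fin d) :
      (EuclideanSpace.single k.succ.succ (1 : ℝ) : EuclideanSpace ℝ (Fin (d + 2))) 1 = 0 := by
    simp [Fin.ext_iff]
  have h' := hA.perp _ _ (h i) (h j)
  simp [minkowski, Fin.ext_iff, hA.null] at h'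
  simp [← Fin.ext_iff] at h'
  linarith

/-- The boost weight of the dual basis covectors. -/
def boostWeight (i : Fin (d + 2)) : SignType :=
  if i = 0 then 1 else if i = 1 then -1 else 0

theorem fin_add_two_cases {p : Fin (d + 2) → Prop} (i : Fin (d + 2)) (h0 : p 0) (h1 : p 1)
    (h2 : ∀ j : Fin d, p j.succ.succ) : p i :=
  Fin.cases h0 (fun i ↦ Fin.cases h1 h2 i) i

@[simp]
theorem boostWeight_zero : boostWeight (0 : Fin (d + 2)) = 1 := rfl

@[simp]
theorem boostWeight_one : boostWeight (1 : Fin (d + 2)) = -1 := rfl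

@[simp]
theorem boostWeight_succ_succ (j : Fin d) : boostWeight j.succ.succ = 0 := by
  simp [boostWeight, Fin.ext_iff]

/-- Components of positive boost weight vanish for an algebraic curvature tensor of which all
curvature operators are in the Lie algebra of `GN`. -/
theorem curvature_component_eq_zero
    {R : Fin (d + 2) → Fin (d + 2) → EuclideanSpace ℝ (Fin (d + 2)) →
      EuclideanSpace ℝ (Fin (d + 2))}
    (hR : ∀ a b, IsInfNull (R a b)) (swap : ∀ a b v, R a b v = - R b a v)
    (bianchi : ∀ a b c, R a b (EuclideanSpace.single c 1) + R b c (EuclideanSpace.single a 1) +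
      R c a (EuclideanSpace.single b 1) = 0) {a b c e : Fin (d + 2)}
    (h : 0 < (boostWeight a + boostWeight b + boostWeight c - boostWeight e : ℤ)) :
    R a b (EuclideanSpace.single c 1) e = 0 := by
  have hk (a b) {i : Fin (d + 2)} (hi : i ≠ 0) : R a b (EuclideanSpace.single 0 1) i = 0 :=
    (hR a b).map_nullVec i hi
  have hl (a b) {i : Fin (d + 2)} (hi : i ≠ 1) : R a b (EuclideanSpace.single i 1) 1 = 0 := by
    rw [(hR a b).null]
    simp [hi.symm]
  have hkl (a b) : R a b (EuclideanSpace.single 1 1) 1 =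
      - R a b (EuclideanSpace.single 0 1) 0 := by
    rw [(hR a b).null]
    simp [nullVec]
  have hs (i : Fin d) : i.succ.succ ≠ 0 ∧ i.succ.succ ≠ 1 := by simp [Fin.ext_iff]
  have self (a v) : R a a v = 0 := by
    ext i
    have := congr($(swap a a v) i)
    rw [PiLp.neg_apply] at this
    rw [PiLp.zero_apply]
    linarith
  have bi (a b c e) : R a b (EuclideanSpace.single c 1) e + R b c (EuclideanSpace.single a 1) e +
      R c a (EuclideanSpace.single b 1) e = 0 := congr($(bianchi a b c) e)
  -- Take the `l`-coordinate of Bianchi for `k, mᵢ, l`: `R(mᵢ, l) k` lies in `ℝk` and `R(l, k) mᵢ`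
  -- in `{k}^⊥`, so neither contributes.
  have km1 (i : Fin d) : R 0 i.succ.succ (EuclideanSpace.single 1 1) 1 = 0 := by
    have := bi 0 i.succ.succ 1 1
    rwa [hk _ _ one_ne_zero, hl _ _ (hs i).2, add_zero, add_zero] at this
  have km0 (i : Fin d) : R 0 i.succ.succ (EuclideanSpace.single 0 1) 0 = 0 := by
    rw [← neg_eq_zero, ← hkl, km1]
  have kmm (i j p : Fin d) :
      R 0 i.succ.succ (EuclideanSpace.single j.succ.succ 1) p.succ.succ = 0 := by
    -- In Bianchi for `k, mᵢ, mⱼ` the term `R(mᵢ, mⱼ) k` has no `m`-coordinate, which yields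
    -- symmetry in `i, j`. With skewness in `j, p`, six alternating swaps return the entry to its
    -- negative.
    have sy (i j p : Fin d) : R 0 i.succ.succ (EuclideanSpace.single j.succ.succ 1) p.succ.succ =
        R 0 j.succ.succ (EuclideanSpace.single i.succ.succ 1) p.succ.succ := by
      have := bi 0 i.succ.succ j.succ.succ p.succ.succ
      rw [hk _ _ (hs p).1, swap j.succ.succ, add_zero, PiLp.neg_apply] at this
      linarith
    have sk (i j p : Fin d) := (hR 0 i.succ.succ).skew j p
    linarith [sy i j p, sk j i p, sy j p i, sk p j i, sy p i j, sk i p j]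
  have main (i : Fin d) {c e : Fin (d + 2)}
      (h : 0 < (1 + boostWeight c - boostWeight e : ℤ)) :
      R 0 i.succ.succ (EuclideanSpace.single c 1) e = 0 := by
    induction c using fin_add_two_cases with
    | h0 => induction e using fin_add_two_cases with
      | h0 => exact km0 i
      | h1 => exact hk _ _ one_ne_zero
      | h2 j => exact hk _ _ (hs j).1
    | h1 => induction e using fin_add_two_cases with
      | h0 => simp at h
      | h1 => exact km1 i
      | h2 j => simp at h
    | h2 j => induction e using fin_add_two_cases with
      | h0 => simp at h
      | h1 => exact hl _ _ (hs j).2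
      | h2 j' => exact kmm i j j'
  -- Components excluded by `gn` alone: no operator sends `k` outside `ℝk`, or `mⱼ` outside `{k}^⊥`.
  have low {a b c e : Fin (d + 2)} (h : 0 < (boostWeight c - boostWeight e : ℤ)) :
      R a b (EuclideanSpace.single c 1) e = 0 := by
    induction c using fin_add_two_cases with
    | h0 => exact hk _ _ (by rintro rfl; simp at h)
    | h1 => induction e using fin_add_two_cases <;> simp at h
    | h2 j => induction e using fin_add_two_cases with
      | h1 => exact hl _ _ (hs j).2
      | h0 => simp at h
      | h2 j' => simp at h
  -- For `a ≠ b` the sum `w(a) + w(b)` is at most `0`, leaving `w(c) > w(e)`, except for `{k, mᵢ}`,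
  -- where it is `1` and `main` is needed.
  induction a using fin_add_two_cases with
  | h0 => induction b using fin_add_two_cases with
    | h0 => simp [self]
    | h1 => exact low (by simpa using h)
    | h2 j => exact main j (by simpa using h)
  | h1 => induction b using fin_add_two_cases with
    | h0 => exact low (by simpa using h)
    | h1 => simp [self]
    | h2 j => exact low (by simp at h ⊢; omega)
  | h2 i => induction b using fin_add_two_cases with
    | h0 => rw [swap, PiLp.neg_apply, main i (by simpa using h), neg_zero]
    | h1 => exact low (by simp at h ⊢; omega)
    | h2 j => exact low (by simpa using h)

/-- `boostOrder` asks for levels summing to exactly `0`. From a total at most `0`, levels can be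
raised one unit at a time towards the maximal total `4`, so `0` is attained. -/
theorem exists_le_sum_eq_zero : ∀ p q r t : SignType, (p + q + r + t : ℤ) ≤ 0 →
    ∃ p' q' r' t' : SignType, p ≤ p' ∧ q ≤ q' ∧ r ≤ r' ∧ t ≤ t' ∧
      (p' + q' + r' + t' : ℤ) = 0 := by
  decide +kernel

variable {V : Type*} [AddCommGroup V] [Module ℝ V]

theorem vectorLevel_mono {lam Lam : Submodule ℝ V} (h : lam ≤ Lam) {p q : SignType} (hpq : p ≤ q) :
    vectorLevel lam Lam p ≤ vectorLevel lam Lam q := by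
  cases p <;> cases q <;> first
    | exact le_rfl
    | exact le_top
    | exact h
    | exact absurd hpq (by decide)

theorem covectorLevel_mono {lam Lam : Submodule ℝ V} (h : lam ≤ Lam) {p q : SignType}
    (hpq : p ≤ q) : covectorLevel lam Lam p ≤ covectorLevel lam Lam q := by
  cases p <;> cases q <;> first
    | exact le_rfl
    | exact le_top
    | exact Submodule.dualAnnihilator_anti h
    | exact absurd hpq (by decide)

/-- Tensor products of total level at most `0` have boost order `0`. -/
theorem pure_mem_boostOrder_zero {lam Lam : Submodule ℝ V} (h : lam ≤ Lam)
    {θ : Fin 3 → Module.Dual ℝ V} {v : Fin 1 → V} {σ : Fin 3 → SignType} {t : SignType}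
    (hθ : ∀ i, θ i ∈ covectorLevel lam Lam (σ i)) (hv : v 0 ∈ vectorLevel lam Lam t)
    (hs : (σ 0 + σ 1 + σ 2 + t : ℤ) ≤ 0) : TensorSpace.pure θ v ∈ boostOrder lam Lam 3 1 0 := by
  obtain ⟨p', q', r', t', hp, hq, hr, ht, e⟩ := exists_le_sum_eq_zero _ _ _ _ hs
  refine Submodule.mem_iSup_of_mem ![p', q', r'] (Submodule.mem_iSup_of_mem ![t']
    (Submodule.mem_iSup_of_mem ?_ (Submodule.subset_span ⟨θ, v, fun i ↦ ?_, fun j ↦ ?_, rfl⟩)))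
  · simpa [Fin.sum_univ_succ, add_assoc] using e
  · fin_cases i
    · exact covectorLevel_mono h hp (hθ 0)
    · exact covectorLevel_mono h hq (hθ 1)
    · exact covectorLevel_mono h hr (hθ 2)
  · obtain rfl := Subsingleton.elim j 0
    exact vectorLevel_mono h ht hv

/-- A multilinear map with three covariant and one contravariant factors in a basis. -/
theorem compMultilinearMap_eq_sum {ι : Type*} [Fintype ι] (b : Module.Basis ι ℝ V)
    (T : MultilinearMap ℝ (fun _ : Fin 3 ↦ V) V) :
    (evalOne V).compMultilinearMap T = ∑ r : Fin 3 → ι, ∑ e : ι,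
      b.repr (T fun i ↦ b (r i)) e •
        TensorSpace.pure (fun i ↦ b.coord (r i)) (fun _ : Fin 1 ↦ b e) := by
  classical
  -- On basis vectors only the summand with the same multi-index survives, leaving the expansion of
  -- a single value of `T`.
  refine Module.Basis.ext_multilinear (fun _ ↦ b) fun r ↦ ?_
  ext α
  have hr (r' : Fin 3 → ι) : (∏ i, (b.repr (b (r i))) (r' i)) = if r = r' then 1 else 0 := by
    split_ifs with h
    · simp [h]
    · obtain ⟨i, hi⟩ := Function.ne_iff.1 h
      exact Finset.prod_eq_zero (Finset.mem_univ i) (by simp [hi])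
  simp only [LinearMap.compMultilinearMap_apply, evalOne_apply, sum_apply,
    smul_apply, TensorSpace.pure_apply, Module.Basis.coord_apply, hr]
  simp only [ite_mul, zero_mul, one_mul, smul_ite, smul_zero, Finset.sum_ite_irrel,
    Finset.sum_const_zero, Finset.sum_ite_eq, Finset.mem_univ, if_true]
  conv_lhs => rw [← b.sum_repr (T fun i ↦ b (r i)), map_sum]
  simp

end Algebra
-- Filtration levels of a frame and its dual basis
section Frames

variable {d : ℕ} {V : Type*} [AddCommGroup V] [Module ℝ V] [TopologicalSpace V]

/-- The basis of `V` given by a frame. -/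
noncomputable def frameBasis (u : EuclideanSpace ℝ (Fin (d + 2)) ≃L[ℝ] V) :
    Module.Basis (Fin (d + 2)) ℝ V :=
  (EuclideanSpace.basisFun (Fin (d + 2)) ℝ).toBasis.map u.toLinearEquiv

theorem frameBasis_apply (u : EuclideanSpace ℝ (Fin (d + 2)) ≃L[ℝ] V) (i : Fin (d + 2)) :
    frameBasis u i = u (EuclideanSpace.single i 1) := by
  simp [frameBasis]

theorem frameBasis_repr (u : EuclideanSpace ℝ (Fin (d + 2)) ≃L[ℝ] V) (w : V) (i : Fin (d + 2)) :
    (frameBasis u).repr w i = u.symm w i := by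
  simp [frameBasis]

theorem nullLine_le_nullPerp : nullLine d ≤ nullPerp d := by
  rw [nullLine, Submodule.span_singleton_le_iff_mem, mem_nullPerp]
  simp [nullVec]

/-- The `l`-coordinate vanishes on `{k}^⊥`, the `m`-coordinates vanish on `k`, and the
`k`-coordinate is unrestricted. -/
theorem frameBasis_coord_mem (u : EuclideanSpace ℝ (Fin (d + 2)) ≃L[ℝ] V) (i : Fin (d + 2)) :
    (frameBasis u).coord i ∈ covectorLevel ((nullLine d).map (u : _ →ₗ[ℝ] V))
      ((nullPerp d).map (u : _ →ₗ[ℝ] V)) (boostWeight i) := by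
  induction i using fin_add_two_cases with
  | h0 => exact Submodule.mem_top
  | h1 =>
    change _ ∈ Submodule.dualAnnihilator _
    rw [Submodule.mem_dualAnnihilator]
    rintro _ ⟨w, hw, rfl⟩
    rw [Module.Basis.coord_apply, frameBasis_repr]
    simpa using mem_nullPerp.1 hw
  | h2 j =>
    rw [boostWeight_succ_succ]
    change _ ∈ Submodule.dualAnnihilator _
    rw [Submodule.mem_dualAnnihilator]
    rintro _ ⟨w, hw, rfl⟩
    obtain ⟨c, rfl⟩ := Submodule.mem_span_singleton.1 hw
    rw [Module.Basis.coord_apply, frameBasis_repr]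
    simp [nullVec]

/-- A basis vector has the weight opposite to its dual covector: `k` spans the lowest level, `mⱼ`
lies in `{k}^⊥`, and `l` is unrestricted. -/
theorem frameBasis_mem (u : EuclideanSpace ℝ (Fin (d + 2)) ≃L[ℝ] V) (i : Fin (d + 2)) :
    frameBasis u i ∈ vectorLevel ((nullLine d).map (u : _ →ₗ[ℝ] V))
      ((nullPerp d).map (u : _ →ₗ[ℝ] V)) (-boostWeight i) := by
  rw [frameBasis_apply]
  induction i using fin_add_two_cases with
  | h0 => exact ⟨nullVec d, Submodule.mem_span_singleton_self _, rfl⟩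
  | h1 => exact Submodule.mem_top
  | h2 j =>
    rw [boostWeight_succ_succ]
    exact ⟨_, mem_nullPerp.2 (by simp [Fin.ext_iff]), rfl⟩

end Frames

/-! ### Assembling the type II statement -/

section Curvature

variable {d : ℕ} {M : Type*} [TopologicalSpace M] [T2Space M]
  [ChartedSpace (EuclideanSpace ℝ (Fin (d + 2))) M] [IsManifold (𝓡 (d + 2)) ∞ M]
  {cov : CovariantDerivative (𝓡 (d + 2)) (EuclideanSpace ℝ (Fin (d + 2)))
      (TangentSpace (𝓡 (d + 2)) : M → Type _)}
  [cov.ContMDiffCovariantDerivative ∞]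

/-- The curvature of a torsion-free connection belonging to a `GN`-structure is of type II. -/
theorem isTypeII_curvatureTensor {P : GStructure M (GN d)} (hP : P.IsConnectionIn cov)
    (htorsion : cov.torsion = 0) (x : M) : P.IsTypeII x (curvatureTensor cov x) := by
  obtain ⟨U, hU, hx, s, hs, hsP⟩ := P.exists_section x
  rw [GStructure.IsTypeII, P.nullDist_eq (hsP x hx), P.perpDist_eq (hsP x hx), curvatureTensor,
    compMultilinearMap_eq_sum (frameBasis (s x))]
  refine Submodule.sum_mem _ fun r _ ↦ Submodule.sum_mem _ fun e _ ↦ ?_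
  -- Since the curvature is tensorial, its components may be computed on the frame fields of a local
  -- section of `P`, where the structure equation applies.
  let R (a b : Fin (d + 2)) (v : EuclideanSpace ℝ (Fin (d + 2))) :
      EuclideanSpace ℝ (Fin (d + 2)) := (s x).symm (curvatureOp cov
    (fun y ↦ s y (EuclideanSpace.single a 1)) (fun y ↦ s y (EuclideanSpace.single b 1))
    (fun y ↦ s y v) x)
  have hR : (frameBasis (s x)).repr (curvatureAt cov x fun i ↦ frameBasis (s x) (r i)) e =
      R (r 0) (r 1) (EuclideanSpace.single (r 2) 1) e := by
    simp only [R]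
    rw [frameBasis_repr, ← curvatureAt_apply hU hx (hs _) (hs _) (hs _)]
    have e' : (fun i ↦ frameBasis (s x) (r i)) = ![s x (EuclideanSpace.single (r 0) 1),
        s x (EuclideanSpace.single (r 1) 1), s x (EuclideanSpace.single (r 2) 1)] := by
      funext i
      fin_cases i <;> exact frameBasis_apply _ _
    rw [e']
  rw [hR]
  -- Positive weight: the coefficient is zero. Otherwise the basis tensor itself has boost order
  -- `0`, whatever its coefficient.
  by_cases h : 0 < (boostWeight (r 0) + boostWeight (r 1) + boostWeight (r 2) - boostWeight e : ℤ)
  · rw [curvature_component_eq_zero (R := R)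
      (fun a b ↦ isInfNull_curvatureOp hP hU hs hsP hx (hs _) (hs _)) (fun a b v ↦ ?_)
      (fun a b c ↦ ?_) h, zero_smul]
    · exact Submodule.zero_mem _
    · simp only [R]
      rw [curvatureOp_swap, map_neg]
    · simp only [R]
      rw [← map_add, ← map_add, curvatureOp_bianchi htorsion hU hx (hs _) (hs _) (hs _), map_zero]
  · refine Submodule.smul_mem _ _ (pure_mem_boostOrder_zero
      (Submodule.map_mono nullLine_le_nullPerp) (fun i ↦ frameBasis_coord_mem (s x) (r i))
      (frameBasis_mem (s x) e) ?_)
    simp only [SignType.coe_neg]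
    omega

end Curvature

end NullGeometry

theorem mainTheorem5 {d : ℕ} {M : Type*} [TopologicalSpace M] [T2Space M]
    [ChartedSpace (EuclideanSpace ℝ (Fin (d + 2))) M] [IsManifold (𝓡 (d + 2)) ∞ M]
    (P : NullGeometry.GStructure M (NullGeometry.GN d))
    (cov : CovariantDerivative (𝓡 (d + 2)) (EuclideanSpace ℝ (Fin (d + 2)))
      (TangentSpace (𝓡 (d + 2)) : M → Type _))
    [cov.ContMDiffCovariantDerivative ∞]
    (hP : P.IsConnectionIn cov) (htorsion : cov.torsion = 0) :
    ∀ x : M, P.IsTypeII x (NullGeometry.curvatureTensor cov x) :=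
  NullGeometry.isTypeII_curvatureTensor hP htorsion
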